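/- Call a set of points of the plane a *curve* if it is a nondegenerate (closed) line segment or a (closed) circular arc of positive radius and of angle strictly between $0$ and $2\pi$. A *planar soap bubble cluster* is a finite collection $B$ of curves with the following properties. (1) The curves do not cross: two different curves of $B$ meet at most in points that are endpoints of both. (2) At each endpoint of a curve of $B$ exactly three curves of $B$ meet, and they form angles of $2\pi/3$ with each other. (3) (Young--Laplace equation.) Call the connected components of the complement of the union of the curves, including the unbounded one, the *bubbles*. Each bubble can be assigned a real number, its pressure, and there is a constant $\gamma>0$, such that for every circular arc of $B$ of radius $r$ and every relatively interior point of it, the pressure of the bubble adjacent on the concave side (the side of the center of the arc) minus the pressure of the bubble adjacent on the other side is $\gamma/r$, and such that at every relatively interior point of a line segment of $B$ the bubbles on its two sides have equal pressures. A *Möbius transformation* is a map of the extended plane $\mathbb{C}\cup\{\infty\}$ of the form $z\mapsto\frac{az+b}{cz+d}$ with $a,b,c,d\in\mathbb{C}$, $ad-bc\neq 0$, or the complex conjugate of such a map. A *double ray* is the union of two disjoint, oppositely oriented closed rays on a common line. **Lemma.** Let $B$ be a planar soap bubble cluster, and let $\tau$ be a Möbius transformation such that for no curve of $B$ the image under $\tau$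 (apart from the point $\infty$) is a ray or a double ray. Then $\tau(B)$, the collection of the images of the curves of $B$, is also a planar soap bubble cluster. -/

import Mathlib

open Set Filter Topology

/-- A directed circular arc or line segment in the plane, given as the unit-speed curve of constant
signed curvature `curvature` and of length `length` that leaves `base` in the unit direction `dir`.
Curvature `0` gives a line segment, positive curvature a circular arc turning to the left
(counterclockwise), negative curvature one turning to the right.  The total turning is less than
`2π`, so that the curve is not closed and does not overlap itself. -/
structure CurveArc where
  base : ℂ
  dir : ℂ
  curvature : ℝ
  length : ℝ
  norm_dir : ‖dir‖ = 1
  length_pos : 0 < length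
  turning_lt : |curvature| * length < 2 * Real.pi

namespace CurveArc

/-- The unit tangent vector after arc length `t`. -/
noncomputable def tangent (c : CurveArc) (t : ℝ) : ℂ :=
  c.dir * Complex.exp ((c.curvature * t : ℝ) * Complex.I)

/-- The point at arc length `t`. -/
noncomputable def point (c : CurveArc) (t : ℝ) : ℂ :=
  c.base + ∫ s in (0 : ℝ)..t, c.tangent s

/-- The set of points of the (closed) arc or segment. -/
noncomputable def carrier (c : CurveArc) : Set ℂ :=
  c.point '' Icc 0 c.length

/-- `p` is an endpoint of `c`, and `v` is the unit tangent vector with which `c` leaves `p`. -/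
def LeavesFrom (c : CurveArc) (p v : ℂ) : Prop :=
  (p = c.point 0 ∧ v = c.tangent 0) ∨ (p = c.point c.length ∧ v = -c.tangent c.length)

/-- `p` is one of the two endpoints of `c`. -/
def IsEndpoint (c : CurveArc) (p : ℂ) : Prop :=
  p = c.point 0 ∨ p = c.point c.length

/-- The points of a curve of curvature `0`. -/
theorem point_of_curvature_eq_zero (c : CurveArc) (h : c.curvature = 0) (t : ℝ) :
    c.point t = c.base + t * c.dir := by
  simp [point, tangent, h]

/-- A curve of curvature `κ ≠ 0` rotates about the center `base + dir * I / κ`. -/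
theorem point_of_curvature_ne_zero (c : CurveArc) (h : c.curvature ≠ 0) (t : ℝ) :
    c.point t = (c.base + c.dir * Complex.I / c.curvature) +
      (-(c.dir * Complex.I / c.curvature)) * Complex.exp ((c.curvature * t : ℝ) * Complex.I) := by
  have hc : (c.curvature : ℂ) * Complex.I ≠ 0 :=
    mul_ne_zero (by exact_mod_cast h) Complex.I_ne_zero
  have h1 : ∀ s : ℝ, c.tangent s = c.dir * Complex.exp ((c.curvature * Complex.I) * s) := by
    intro s
    unfold tangent
    congr 2
    push_cast
    ring
  have hk : (c.curvature : ℂ) ≠ 0 := by exact_mod_cast h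
  have hI : Complex.I ^ 2 = -1 := Complex.I_sq
  have h2 : ((c.curvature * t : ℝ) : ℂ) * Complex.I = (c.curvature * Complex.I) * t := by
    push_cast
    ring
  unfold point
  simp only [h1]
  rw [intervalIntegral.integral_const_mul, integral_exp_mul_complex hc, h2]
  have hI' := Complex.I_ne_zero
  simp only [Complex.ofReal_zero, mul_zero, Complex.exp_zero]
  field_simp
  linear_combination (c.dir * Complex.exp (c.curvature * Complex.I * t) - c.dir) * hI

/-- The sets carried by these curves are exactly the nondegenerate line segments and the circular
arcs of angle strictly between `0` and `2π`. -/
theorem exists_carrier_eq_iff (X : Set ℂ) :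
    (∃ c : CurveArc, c.carrier = X) ↔
      (∃ a b : ℂ, a ≠ b ∧ X = segment ℝ a b) ∨
      (∃ (o : ℂ) (r α β : ℝ), 0 < r ∧ α < β ∧ β < α + 2 * Real.pi ∧
        X = circleMap o r '' Icc α β) := by
  constructor
  · rintro ⟨c, rfl⟩
    by_cases hk : c.curvature = 0
    · left
      have hd : c.dir ≠ 0 := norm_ne_zero_iff.1 (by rw [c.norm_dir]; exact one_ne_zero)
      have hl : (c.length : ℂ) ≠ 0 := by exact_mod_cast c.length_pos.ne'
      refine ⟨c.base, c.base + c.length * c.dir, ?_, ?_⟩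
      · intro h
        exact mul_ne_zero hl hd (by linear_combination -h)
      · rw [segment_eq_image', carrier]
        ext z
        simp only [mem_image, point_of_curvature_eq_zero c hk, Complex.real_smul,
          add_sub_cancel_left]
        constructor
        · rintro ⟨t, ⟨h0, h1⟩, rfl⟩
          refine ⟨t / c.length, ⟨div_nonneg h0 c.length_pos.le,
            (div_le_one c.length_pos).2 h1⟩, ?_⟩
          push_cast
          field_simp
        · rintro ⟨t, ⟨h0, h1⟩, rfl⟩
          refine ⟨t * c.length, ⟨mul_nonneg h0 c.length_pos.le,
            mul_le_of_le_one_left c.length_pos.le h1⟩, ?_⟩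
          push_cast
          ring
    · right
      set w : ℂ := -(c.dir * Complex.I / c.curvature) with hw
      have hwn : ‖w‖ = 1 / |c.curvature| := by
        simp [hw, c.norm_dir]
      have hpt : c.point = circleMap (c.base + c.dir * Complex.I / c.curvature)
          (1 / |c.curvature|) ∘ (fun t => c.curvature * t + w.arg) := by
        funext t
        rw [point_of_curvature_ne_zero c hk t, ← hw, Function.comp, circleMap]
        congr 1
        conv_lhs => rw [← Complex.norm_mul_exp_arg_mul_I w]
        rw [mul_assoc, ← Complex.exp_add, hwn]
        congr 2
        push_cast
        ring
      have ht := c.turning_lt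
      rcases lt_or_gt_of_ne hk with hneg | hpos
      · rw [abs_of_neg hneg] at ht
        refine ⟨c.base + c.dir * Complex.I / c.curvature, 1 / |c.curvature|,
          c.curvature * c.length + w.arg, w.arg, by positivity, ?_, by linarith, ?_⟩
        · linarith [mul_neg_of_neg_of_pos hneg c.length_pos]
        · rw [carrier, hpt, image_comp]
          congr 1
          ext x
          simp only [mem_image, mem_Icc]
          constructor
          · rintro ⟨t, ⟨h0, h1⟩, rfl⟩
            constructor <;> nlinarith
          · rintro ⟨h0, h1⟩
            refine ⟨(x - w.arg) / c.curvature, ⟨?_, ?_⟩, by field_simp; ring⟩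
            · exact div_nonneg_of_nonpos (by linarith) hneg.le
            · rw [div_le_iff_of_neg hneg]
              linarith
      · rw [abs_of_pos hpos] at ht
        refine ⟨c.base + c.dir * Complex.I / c.curvature, 1 / |c.curvature|,
          w.arg, c.curvature * c.length + w.arg, by positivity, ?_, by linarith, ?_⟩
        · linarith [mul_pos hpos c.length_pos]
        · rw [carrier, hpt, image_comp, image_affine_Icc' hpos]
          simp
  · rintro (⟨a, b, hab, rfl⟩ | ⟨o, r, α, β, hr, hαβ, hβ, rfl⟩)
    · have hn : 0 < ‖b - a‖ := norm_pos_iff.2 (sub_ne_zero.2 hab.symm)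
      have hn' : ((‖b - a‖ : ℝ) : ℂ) ≠ 0 := by exact_mod_cast hn.ne'
      have hd : ‖(b - a) / (‖b - a‖ : ℝ)‖ = 1 := by
        rw [norm_div, Complex.norm_real, norm_norm, div_self hn.ne']
      have hz : |(0 : ℝ)| * ‖b - a‖ < 2 * Real.pi := by simpa using Real.pi_pos
      have hpt := point_of_curvature_eq_zero
        ⟨a, (b - a) / (‖b - a‖ : ℝ), 0, ‖b - a‖, hd, hn, hz⟩ rfl
      refine ⟨⟨a, (b - a) / (‖b - a‖ : ℝ), 0, ‖b - a‖, hd, hn, hz⟩, ?_⟩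
      · rw [segment_eq_image', carrier]
        ext z
        simp only [mem_image, hpt, Complex.real_smul]
        constructor
        · rintro ⟨t, ⟨h0, h1⟩, rfl⟩
          refine ⟨t / ‖b - a‖, ⟨div_nonneg h0 hn.le, (div_le_one hn).2 h1⟩, ?_⟩
          push_cast
          field_simp
        · rintro ⟨t, ⟨h0, h1⟩, rfl⟩
          refine ⟨t * ‖b - a‖, ⟨mul_nonneg h0 hn.le, mul_le_of_le_one_left hn.le h1⟩, ?_⟩
          push_cast
          field_simp
    · have hr' : (r : ℂ) ≠ 0 := by exact_mod_cast hr.ne'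
      have hk : 1 / r ≠ 0 := by positivity
      refine ⟨⟨circleMap o r α, Complex.I * Complex.exp (α * Complex.I), 1 / r, r * (β - α),
        ?_, mul_pos hr (by linarith), ?_⟩, ?_⟩
      · rw [norm_mul, Complex.norm_I, Complex.norm_exp_ofReal_mul_I, one_mul]
      · rw [abs_of_pos (by positivity)]
        field_simp
        linarith
      · rw [carrier]
        have hpt : ∀ t : ℝ, point ⟨circleMap o r α, Complex.I * Complex.exp (α * Complex.I), 1 / r,
            r * (β - α), by rw [norm_mul, Complex.norm_I, Complex.norm_exp_ofReal_mul_I, one_mul],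
            mul_pos hr (by linarith), by
              rw [abs_of_pos (by positivity)]
              field_simp
              linarith⟩ t = circleMap o r (1 / r * t + α) := by
          intro t
          rw [point_of_curvature_ne_zero _ hk]
          have hI : Complex.I ^ 2 = -1 := Complex.I_sq
          have he : ((1 / r * t + α : ℝ) : ℂ) * Complex.I =
              α * Complex.I + ((1 / r * t : ℝ) : ℂ) * Complex.I := by
            push_cast
            ring
          simp only [circleMap]
          rw [he, Complex.exp_add]
          push_cast
          field_simp
          linear_combination (r * Complex.exp (α * Complex.I) - r * Complex.exp (α * Complex.I) *
            Complex.exp (Complex.I * t / r)) * hI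
        rw [funext hpt]
        rw [show (fun t : ℝ => circleMap o r (1 / r * t + α)) =
          circleMap o r ∘ (fun t => 1 / r * t + α) from rfl, image_comp,
          image_affine_Icc' (by positivity)]
        congr 2
        · ring
        · field_simp
          ring

end CurveArc

/-- The part of the plane covered by a finite collection of curves. -/
noncomputable def film (S : Finset CurveArc) : Set ℂ :=
  ⋃ c ∈ S, c.carrier

/-- The bubbles of a collection of curves (including the unbounded outside region): the connected
components of the complement of the curves. -/
def IsBubble (S : Finset CurveArc) (W : Set ℂ) : Prop :=
  ∃ z ∈ (film S)ᶜ, W = connectedComponentIn (film S)ᶜ z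

/-- The planar form of Plateau's laws. -/
structure PlateauLaws (S : Finset CurveArc) : Prop where
  /-- The curves do not cross: two of them meet at most in common endpoints. -/
  noncrossing : ∀ c ∈ S, ∀ d ∈ S, c ≠ d → ∀ p ∈ c.carrier ∩ d.carrier,
    c.IsEndpoint p ∧ d.IsEndpoint p
  /-- Exactly three curves meet at each endpoint. -/
  three_meet : ∀ c ∈ S, ∀ p, c.IsEndpoint p → {d | d ∈ S ∧ p ∈ d.carrier}.ncard = 3
  /-- The curves that meet at an endpoint form angles of `2π/3` with each other. -/
  angle_eq : ∀ c ∈ S, ∀ d ∈ S, c ≠ d → ∀ p v w, c.LeavesFrom p v → d.LeavesFrom p w →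
    InnerProductGeometry.angle v w = 2 * Real.pi / 3

/-- The region `W` lies next to the point `z`, on the side into which the vector `n` points. -/
def LiesOnSide (W : Set ℂ) (z n : ℂ) : Prop :=
  ∀ᶠ ε : ℝ in 𝓝[>] 0, z + ε * n ∈ W

/-- The planar Young--Laplace equation, for the pressures `P` of the bubbles and the constant of
proportionality `γ`: at each point in the relative interior of a curve, the pressure to the left
minus the pressure to the right is `γ` times the signed curvature.  (For positive signed curvature
the center of curvature is on the left, so the pressure is higher on the concave side.) -/
def YoungLaplace (S : Finset CurveArc) (γ : ℝ) (P : Set ℂ → ℝ) : Prop :=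
  ∀ c ∈ S, ∀ t ∈ Ioo 0 c.length, ∀ W W' : Set ℂ, IsBubble S W → IsBubble S W' →
    LiesOnSide W (c.point t) (Complex.I * c.tangent t) →
    LiesOnSide W' (c.point t) (-(Complex.I * c.tangent t)) →
    P W - P W' = γ * c.curvature

/-- A planar soap bubble cluster: a finite collection `B` of circular arcs and line segments that
obeys Plateau's laws and, for some assignment of pressures to the bubbles, the Young--Laplace
equation. -/
def IsSoapBubbleCluster (B : Set (Set ℂ)) : Prop :=
  ∃ S : Finset CurveArc, B = CurveArc.carrier '' (S : Set CurveArc) ∧ PlateauLaws S ∧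
    ∃ γ > 0, ∃ P : Set ℂ → ℝ, YoungLaplace S γ P

/-- A Möbius transformation of the extended plane: a fractional linear transformation, or the
complex conjugate of one. -/
def IsMobius (τ : OnePoint ℂ → OnePoint ℂ) : Prop :=
  ∃ g : GL (Fin 2) ℂ, (∀ z, τ z = g • z) ∨
    (∀ z, τ z = OnePoint.map (starRingEnd ℂ) (g • z))

/-- The finite part of the image of a plane set under a map of the extended plane. -/
def planeImage (τ : OnePoint ℂ → OnePoint ℂ) (X : Set ℂ) : Set ℂ :=
  {w | ∃ z ∈ X, τ (z : OnePoint ℂ) = (w : OnePoint ℂ)}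

/-- A closed ray. -/
def IsRay (X : Set ℂ) : Prop :=
  ∃ a v : ℂ, v ≠ 0 ∧ X = {z | ∃ t : ℝ, 0 ≤ t ∧ z = a + t * v}

/-- A double ray: two disjoint oppositely oriented closed rays on a common line. -/
def IsDoubleRay (X : Set ℂ) : Prop :=
  ∃ (a v : ℂ) (s : ℝ), v ≠ 0 ∧ 0 < s ∧
    X = {z | ∃ t : ℝ, (t ≤ 0 ∨ s ≤ t) ∧ z = a + t * v}

/-! Plateau's laws are local, and a Möbius transformation whose pole lies on no curve is conformal
along the curves and turns arcs and segments into arcs and segments, so these laws carry over at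
once. The Young--Laplace equation is the real issue, because the pressures of the image have to be
found. The way out is to replace the pressures by a condition at the vertices: given Plateau's laws,
pressures exist if and only if the signed curvatures of the three curves leaving each vertex sum to
zero (`CurvatureBalance`).

Pressures give balance (`curvatureBalance`): near a vertex the three curves are separated by three
sectors, each lying in one bubble, and the three pressure differences met on going around the vertex
telescope to zero.

Balance gives pressures (`exists_youngLaplace`): consider the sum over the curves of the curvature
times the integral of `1 / (ζ - z)` along the curve. Its derivative in `z` is a combination of terms
`1 / (p - z)` over the vertices `p`, with coefficients that vanish by balance, so it is constant on
each bubble. Across a curve it jumps by `2πi` times the curvature. The real part after division by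
`2πi` is therefore a system of pressures with `γ = 1`.

Balance is preserved: under `z ↦ 1 / z` a curve through `p` with unit tangent `T` and curvature `κ`
acquires the curvature `|p|² κ - 2 Im (conj p * T)`. At a fixed vertex this is additive in the pair
of outgoing curvature and outgoing tangent. The curvatures sum to zero by assumption and the
tangents because of the angles `2π/3`, hence so do the new curvatures (`isSoapBubbleCluster_image`).
Affine maps and conjugation only multiply curvatures by a constant, and every Möbius transformation
is composed of these maps. The condition on rays excludes a pole on a curve, since inversion at a
point of a curve produces a ray or a double ray (`CurveArc.isRay_or_isDoubleRay`). -/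

namespace CurveArc

/-! ### Elementary geometry of curves of constant curvature. -/

theorem dir_ne_zero (c : CurveArc) : c.dir ≠ 0 :=
  norm_ne_zero_iff.1 (by rw [c.norm_dir]; exact one_ne_zero)

@[simp] theorem point_zero (c : CurveArc) : c.point 0 = c.base := by simp [point]

@[simp] theorem tangent_zero (c : CurveArc) : c.tangent 0 = c.dir := by simp [tangent]

theorem norm_tangent (c : CurveArc) (t : ℝ) : ‖c.tangent t‖ = 1 := by
  rw [tangent, norm_mul, Complex.norm_exp_ofReal_mul_I, c.norm_dir, one_mul]

theorem tangent_ne_zero (c : CurveArc) (t : ℝ) : c.tangent t ≠ 0 :=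
  norm_ne_zero_iff.1 (by rw [c.norm_tangent]; exact one_ne_zero)

theorem hasDerivAt_tangent (c : CurveArc) (t : ℝ) :
    HasDerivAt c.tangent (Complex.I * c.curvature * c.tangent t) t := by
  have h1 : HasDerivAt (fun t : ℝ => ((c.curvature * t : ℝ) : ℂ) * Complex.I)
      (((c.curvature * 1 : ℝ) : ℂ) * Complex.I) t :=
    (((hasDerivAt_id t).const_mul c.curvature).ofReal_comp).mul_const _
  refine (h1.cexp.const_mul c.dir).congr_deriv ?_
  simp only [tangent]
  push_cast
  ring

theorem continuous_tangent (c : CurveArc) : Continuous c.tangent :=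
  continuous_iff_continuousAt.2 fun t => (c.hasDerivAt_tangent t).continuousAt

theorem hasDerivAt_point (c : CurveArc) (t : ℝ) : HasDerivAt c.point (c.tangent t) t :=
  (intervalIntegral.integral_hasDerivAt_right (c.continuous_tangent.intervalIntegrable _ _)
    (c.continuous_tangent.stronglyMeasurableAtFilter _ _)
    c.continuous_tangent.continuousAt).const_add _

theorem continuous_point (c : CurveArc) : Continuous c.point :=
  continuous_iff_continuousAt.2 fun t => (c.hasDerivAt_point t).continuousAt

/-- Along a curve of constant curvature the tangent is an affine function of the point. -/
theorem tangent_sub_tangent (c : CurveArc) (s t : ℝ) :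
    c.tangent t - c.tangent s = Complex.I * c.curvature * (c.point t - c.point s) := by
  have h : ∀ x, HasDerivAt (fun x => c.tangent x - Complex.I * c.curvature * c.point x) 0 x := by
    intro x
    exact ((c.hasDerivAt_tangent x).fun_sub ((c.hasDerivAt_point x).const_mul _)).congr_deriv
      (sub_self _)
  have := is_const_of_deriv_eq_zero (fun x => (h x).differentiableAt) (fun x => (h x).deriv) t s
  linear_combination this

theorem tangent_add (c : CurveArc) (s t : ℝ) :
    c.tangent (s + t) = c.tangent s * Complex.exp ((c.curvature * t : ℝ) * Complex.I) := by
  rw [tangent, tangent, mul_assoc, ← Complex.exp_add]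
  congr 2
  push_cast
  ring

/-- The points of a curve that starts at the origin in the direction `1` lie on a circle. -/
theorem im_chord (c : CurveArc) (s t : ℝ) :
    2 * ((c.point t - c.point s) / c.tangent s).im =
      c.curvature * Complex.normSq (c.point t - c.point s) := by
  by_cases hk : c.curvature = 0
  · have hd := c.dir_ne_zero
    have : (c.point t - c.point s) / c.tangent s = ((t - s : ℝ) : ℂ) := by
      rw [point_of_curvature_eq_zero c hk, point_of_curvature_eq_zero c hk, tangent, hk]
      push_cast
      field_simp
      simp
      ring
    rw [this, Complex.ofReal_im, hk]
    ring
  · have h0 := c.tangent_ne_zero s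
    set u := (c.point t - c.point s) / c.tangent s with hu
    -- The ratio of the tangents is a unit vector, so `|1 + iκu|² = 1`; expanding and cancelling one
    -- factor `κ` gives the claim.
    have h1 : c.tangent t / c.tangent s = 1 + Complex.I * c.curvature * u := by
      rw [hu]
      field_simp
      linear_combination c.tangent_sub_tangent s t
    have h2 : Complex.normSq (c.tangent t / c.tangent s) = 1 := by
      rw [Complex.normSq_eq_norm_sq, norm_div, c.norm_tangent, c.norm_tangent]
      norm_num
    have h3 : Complex.normSq (c.point t - c.point s) = Complex.normSq u := by
      rw [hu, map_div₀, Complex.normSq_eq_norm_sq (c.tangent s), c.norm_tangent]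
      norm_num
    rw [h1, Complex.normSq_apply] at h2
    rw [h3, Complex.normSq_apply]
    simp at h2
    apply mul_left_cancel₀ hk
    linarith

/-- For nonzero curvature the point determines the tangent, so a repeated point would force `κ (t -
s)` to be a multiple of `2π`; the bound on the total turning leaves only the multiple zero. -/
theorem point_injOn (c : CurveArc) : InjOn c.point (Icc 0 c.length) := by
  intro s hs t ht hst
  by_cases hk : c.curvature = 0
  · rw [point_of_curvature_eq_zero c hk, point_of_curvature_eq_zero c hk] at hst
    have := mul_right_cancel₀ c.dir_ne_zero (add_left_cancel hst)
    exact_mod_cast this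
  · have h := c.tangent_sub_tangent s t
    rw [hst, sub_self, mul_zero, sub_eq_zero, tangent, tangent] at h
    obtain ⟨n, hn⟩ := Complex.exp_eq_exp_iff_exists_int.1 (mul_left_cancel₀ c.dir_ne_zero h)
    have h1 : c.curvature * (t - s) = n * (2 * Real.pi) := by
      have : ((c.curvature * (t - s) : ℝ) : ℂ) * Complex.I
          = ((n * (2 * Real.pi) : ℝ) : ℂ) * Complex.I := by
        push_cast at hn ⊢
        linear_combination hn
      exact_mod_cast mul_right_cancel₀ Complex.I_ne_zero this
    have h2 : |c.curvature * (t - s)| < 2 * Real.pi := by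
      refine lt_of_le_of_lt ?_ c.turning_lt
      rw [abs_mul]
      refine mul_le_mul_of_nonneg_left ?_ (abs_nonneg _)
      rw [abs_le]
      constructor <;> linarith [hs.1, hs.2, ht.1, ht.2]
    have hpi := Real.two_pi_pos
    have hn0 : n = 0 := by
      rw [h1, abs_mul, abs_of_pos hpi] at h2
      have h3 : |(n : ℝ)| < 1 := by
        by_contra h4
        push Not at h4
        nlinarith
      exact Int.abs_lt_one_iff.1 (by exact_mod_cast h3)
    rw [hn0, Int.cast_zero, zero_mul] at h1
    rcases mul_eq_zero.1 h1 with h3 | h3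
    · exact absurd h3 hk
    · linarith

theorem isCompact_carrier (c : CurveArc) : IsCompact c.carrier :=
  isCompact_Icc.image c.continuous_point

theorem point_mem_carrier (c : CurveArc) {t : ℝ} (ht : t ∈ Icc 0 c.length) :
    c.point t ∈ c.carrier := mem_image_of_mem _ ht

theorem zero_mem (c : CurveArc) : (0 : ℝ) ∈ Icc 0 c.length := ⟨le_rfl, c.length_pos.le⟩

theorem length_mem (c : CurveArc) : c.length ∈ Icc 0 c.length := ⟨c.length_pos.le, le_rfl⟩

theorem IsEndpoint.mem_carrier {c : CurveArc} {p : ℂ} (h : c.IsEndpoint p) : p ∈ c.carrier := by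
  rcases h with rfl | rfl
  · exact c.point_mem_carrier c.zero_mem
  · exact c.point_mem_carrier c.length_mem

theorem point_zero_ne_point_length (c : CurveArc) : c.point 0 ≠ c.point c.length :=
  fun h => c.length_pos.ne (c.point_injOn c.zero_mem c.length_mem h)

theorem not_isEndpoint (c : CurveArc) {t : ℝ} (ht : t ∈ Ioo 0 c.length) :
    ¬ c.IsEndpoint (c.point t) := by
  rintro (h | h)
  · exact ht.1.ne' (c.point_injOn (Ioo_subset_Icc_self ht) c.zero_mem h)
  · exact ht.2.ne (c.point_injOn (Ioo_subset_Icc_self ht) c.length_mem h)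

/-- The same curve, traversed in the opposite direction. -/
noncomputable def reverse (c : CurveArc) : CurveArc where
  base := c.point c.length
  dir := -c.tangent c.length
  curvature := -c.curvature
  length := c.length
  norm_dir := by rw [norm_neg, c.norm_tangent]
  length_pos := c.length_pos
  turning_lt := by rw [abs_neg]; exact c.turning_lt

theorem reverse_tangent (c : CurveArc) (t : ℝ) :
    c.reverse.tangent t = -c.tangent (c.length - t) := by
  rw [sub_eq_add_neg, c.tangent_add]
  simp [tangent, reverse]

theorem reverse_point (c : CurveArc) (t : ℝ) : c.reverse.point t = c.point (c.length - t) := by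
  have h : ∀ x, HasDerivAt (fun x => c.reverse.point x - c.point (c.length - x)) 0 x := by
    intro x
    have h1 : HasDerivAt (fun x => c.length - x) (-1) x := (hasDerivAt_id x).const_sub _
    refine ((c.reverse.hasDerivAt_point x).fun_sub
      ((c.hasDerivAt_point (c.length - x)).scomp x h1)).congr_deriv ?_
    rw [c.reverse_tangent]
    simp
  have := is_const_of_deriv_eq_zero (fun x => (h x).differentiableAt) (fun x => (h x).deriv) t 0
  simp only [point_zero, sub_zero] at this
  rw [show c.reverse.base = c.point c.length from rfl, sub_self, sub_eq_zero] at this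
  exact this

theorem reverse_carrier (c : CurveArc) : c.reverse.carrier = c.carrier := by
  rw [carrier, carrier, funext c.reverse_point,
    show (fun t => c.point (c.length - t)) = c.point ∘ (fun t => c.length - t) from rfl,
    image_comp]
  congr 1
  rw [show c.reverse.length = c.length from rfl]
  simp

end CurveArc

theorem isCompact_film (S : Finset CurveArc) : IsCompact (film S) :=
  S.finite_toSet.isCompact_biUnion fun c _ => c.isCompact_carrier

theorem carrier_subset_film {S : Finset CurveArc} {c : CurveArc} (hc : c ∈ S) :
    c.carrier ⊆ film S := subset_biUnion_of_mem (u := fun c : CurveArc => c.carrier) hc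

/-! ### Cauchy integrals along a curve and their jump across it. -/

namespace CurveArc

/-- The Cauchy integral of the constant function `1` over a part of a curve. -/
noncomputable def cauchy (c : CurveArc) (a b : ℝ) (z : ℂ) : ℂ :=
  ∫ s in a..b, c.tangent s / (c.point s - z)

theorem continuousOn_cauchyKernel (c : CurveArc) {K : Set ℝ} {z : ℂ}
    (hz : ∀ s ∈ K, c.point s ≠ z) (n : ℕ) :
    ContinuousOn (fun s => c.tangent s / (c.point s - z) ^ n) K :=
  c.continuous_tangent.continuousOn.div
    ((c.continuous_point.sub continuous_const).pow n).continuousOn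
    fun s hs => pow_ne_zero _ (sub_ne_zero.2 (hz s hs))

theorem intervalIntegrable_cauchyKernel (c : CurveArc) {a b : ℝ} {z : ℂ}
    (hz : ∀ s ∈ uIcc a b, c.point s ≠ z) :
    IntervalIntegrable (fun s => c.tangent s / (c.point s - z)) MeasureTheory.volume a b := by
  simpa using (c.continuousOn_cauchyKernel hz 1).intervalIntegrable

/-- Differentiation under the integral sign produces `tangent / (point - z) ^ 2`, which has the
primitive `-1 / (point - z)` in the arc length. Only the two endpoints of the piece survive. -/
theorem hasDerivAt_cauchy (c : CurveArc) {a b : ℝ} {z : ℂ}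
    (hz : ∀ s ∈ uIcc a b, c.point s ≠ z) :
    HasDerivAt (c.cauchy a b) (1 / (c.point a - z) - 1 / (c.point b - z)) z := by
  have hK : IsCompact (c.point '' uIcc a b) := isCompact_uIcc.image c.continuous_point
  have hzK : z ∉ c.point '' uIcc a b := by
    rintro ⟨s, hs, h⟩
    exact hz s hs h
  obtain ⟨δ, hδ, hb⟩ := Metric.mem_nhds_iff.1 (hK.isClosed.isOpen_compl.mem_nhds hzK)
  have hfar : ∀ x ∈ Metric.ball z (δ / 2), ∀ s ∈ uIcc a b, δ / 2 ≤ ‖c.point s - x‖ := by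
    intro x hx s hs
    have h1 : δ ≤ dist (c.point s) z := by
      by_contra h
      push Not at h
      exact hb (Metric.mem_ball.2 h) (mem_image_of_mem _ hs)
    have h2 := dist_triangle (c.point s) x z
    rw [Metric.mem_ball] at hx
    rw [← dist_eq_norm]
    linarith
  have hne : ∀ x ∈ Metric.ball z (δ / 2), ∀ s ∈ uIcc a b, c.point s ≠ x := by
    intro x hx s hs h
    have := hfar x hx s hs
    rw [h, sub_self, norm_zero] at this
    linarith
  have hmain := (intervalIntegral.hasDerivAt_integral_of_dominated_loc_of_deriv_le
    (F := fun x s => c.tangent s / (c.point s - x))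
    (F' := fun x s => c.tangent s / (c.point s - x) ^ 2) (μ := MeasureTheory.volume)
    (bound := fun _ => 1 / (δ / 2) ^ 2) (a := a) (b := b) (x₀ := z)
    (Metric.ball_mem_nhds z (half_pos hδ)) ?_ ?_ ?_ ?_ ?_ ?_).2
  · refine hmain.congr_deriv ?_
    have hd : ∀ s ∈ uIcc a b, HasDerivAt (fun s => -(1 / (c.point s - z)))
        (c.tangent s / (c.point s - z) ^ 2) s := by
      intro s hs
      have h0 := sub_ne_zero.2 (hz s hs)
      have h1 : HasDerivAt (fun s => c.point s - z) (c.tangent s) s :=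
        (c.hasDerivAt_point s).sub_const _
      simp only [one_div]
      refine (h1.fun_inv h0).fun_neg.congr_deriv ?_
      ring
    rw [intervalIntegral.integral_eq_sub_of_hasDerivAt hd
      (c.continuousOn_cauchyKernel hz 2).intervalIntegrable]
    ring
  · filter_upwards [Metric.ball_mem_nhds z (half_pos hδ)] with x hx
    have := (c.continuousOn_cauchyKernel (hne x hx) 1).mono uIoc_subset_uIcc
    simpa using this.aestronglyMeasurable measurableSet_uIoc
  · exact c.intervalIntegrable_cauchyKernel hz
  · exact ((c.continuousOn_cauchyKernel hz 2).mono uIoc_subset_uIcc).aestronglyMeasurable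
      measurableSet_uIoc
  · refine Eventually.of_forall fun s hs x hx => ?_
    rw [norm_div, c.norm_tangent, norm_pow]
    have := hfar x hx s (uIoc_subset_uIcc hs)
    gcongr
  · exact intervalIntegrable_const
  · refine Eventually.of_forall fun s hs x hx => ?_
    have h0 := sub_ne_zero.2 (hne x hx s (uIoc_subset_uIcc hs))
    have h1 : HasDerivAt (fun x => c.point s - x) (-1) x := (hasDerivAt_id x).const_sub _
    simp only [div_eq_mul_inv]
    refine ((h1.fun_inv h0).const_mul _).congr_deriv ?_
    field_simp

/-- Pieces of curve that avoid `z` are continuous at `z` and so contribute nothing to a jump there.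
-/
theorem tendsto_cauchy_normal (c : CurveArc) {a b : ℝ} {z : ℂ}
    (hz : ∀ s ∈ uIcc a b, c.point s ≠ z) (n : ℂ) :
    Tendsto (fun ε : ℝ => c.cauchy a b (z + ε * n)) (𝓝[>] 0) (𝓝 (c.cauchy a b z)) := by
  have h1 : Continuous fun ε : ℝ => z + ε * n := by fun_prop
  have h2 : Tendsto (fun ε : ℝ => z + ε * n) (𝓝[>] 0) (𝓝 z) := by
    have := (h1.tendsto 0).mono_left (nhdsWithin_le_nhds (s := Ioi (0 : ℝ)))
    simpa using this
  exact (c.hasDerivAt_cauchy hz).continuousAt.tendsto.comp h2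

/-- Near an interior point the curve moves strictly forward in the direction of its tangent. -/
theorem exists_forward (c : CurveArc) (t : ℝ) : ∃ δ > 0,
    StrictMonoOn (fun s => ((c.point s - c.point t) / c.tangent t).re)
      (Icc (t - δ) (t + δ)) := by
  have hc : Continuous fun s => (c.tangent s / c.tangent t).re :=
    Complex.continuous_re.comp (c.continuous_tangent.div_const _)
  have h0 : (0 : ℝ) < (c.tangent t / c.tangent t).re := by
    rw [div_self (c.tangent_ne_zero t)]
    norm_num
  obtain ⟨δ, hδ, hb⟩ := Metric.eventually_nhds_iff.1 (hc.continuousAt.eventually (lt_mem_nhds h0))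
  refine ⟨δ / 2, half_pos hδ, strictMonoOn_of_deriv_pos (convex_Icc _ _) ?_ ?_⟩
  · exact (Complex.continuous_re.comp
      ((c.continuous_point.sub continuous_const).div_const _)).continuousOn
  · intro s hs
    rw [interior_Icc] at hs
    have h1 : HasDerivAt (fun s => (c.point s - c.point t) / c.tangent t)
        (c.tangent s / c.tangent t) s :=
      ((c.hasDerivAt_point s).sub_const _).div_const _
    have h2 : HasDerivAt (fun s => ((c.point s - c.point t) / c.tangent t).re)
        (c.tangent s / c.tangent t).re s :=
      Complex.reCLM.hasFDerivAt.comp_hasDerivAt s h1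
    rw [h2.deriv]
    apply hb
    rw [Real.dist_eq, abs_lt]
    constructor <;> linarith [hs.1, hs.2]

/-- The integral over a short piece of the curve, evaluated at a point on the normal. -/
theorem cauchy_normal_eq (c : CurveArc) {t δ : ℝ} (hδ : 0 < δ)
    (hm : StrictMonoOn (fun s => ((c.point s - c.point t) / c.tangent t).re)
      (Icc (t - δ) (t + δ))) {σ : ℂ} (hσ : σ = Complex.I ∨ σ = -Complex.I) {ε : ℝ} (hε : 0 < ε) :
    c.cauchy (t - δ) (t + δ) (c.point t + ε * (σ * c.tangent t)) =
      Complex.log (σ * ((c.point (t + δ) - c.point t) / c.tangent t) + ε) -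
      Complex.log (σ * ((c.point (t - δ) - c.point t) / c.tangent t) + ε) := by
  have hT := c.tangent_ne_zero t
  have hσ2 : σ * σ = -1 := by rcases hσ with rfl | rfl <;> simp
  have hle : t - δ ≤ t + δ := by linarith
  have htm : t ∈ Icc (t - δ) (t + δ) := ⟨by linarith, by linarith⟩
  -- Up to the constant factor `σ / tangent t`, this is the difference of the point of the curve and
  -- the evaluation point. Away from `t` its imaginary part is nonzero because the curve moves
  -- strictly forward, and at `t` it equals `ε > 0`. The principal logarithm is thus a primitive of
  -- the kernel on the whole piece.
  have hslit : ∀ s ∈ uIcc (t - δ) (t + δ),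
      σ * ((c.point s - c.point t) / c.tangent t) + ε ∈ Complex.slitPlane := by
    intro s hs
    rw [uIcc_of_le hle] at hs
    by_cases hst : s = t
    · subst hst
      rw [sub_self, zero_div, mul_zero, zero_add]
      exact Complex.ofReal_mem_slitPlane.2 hε
    · have h1 : ((c.point s - c.point t) / c.tangent t).re ≠ 0 := by
        intro h
        apply hst
        apply hm.injOn hs htm
        simp only [h, sub_self, zero_div, Complex.zero_re]
      right
      rcases hσ with rfl | rfl <;> simpa using h1
  have hne : ∀ s ∈ uIcc (t - δ) (t + δ), c.point s ≠ c.point t + ε * (σ * c.tangent t) := by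
    intro s hs h
    apply Complex.slitPlane_ne_zero (hslit s hs)
    rw [h]
    field_simp
    linear_combination (ε : ℂ) * c.tangent t * hσ2
  have hd : ∀ s ∈ uIcc (t - δ) (t + δ),
      HasDerivAt (fun s => Complex.log (σ * ((c.point s - c.point t) / c.tangent t) + ε))
        (c.tangent s / (c.point s - (c.point t + ε * (σ * c.tangent t)))) s := by
    intro s hs
    have h1 : HasDerivAt (fun s => σ * ((c.point s - c.point t) / c.tangent t) + ε)
        (σ * (c.tangent s / c.tangent t)) s :=
      ((((c.hasDerivAt_point s).sub_const _).div_const _).const_mul _).add_const _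
    refine (h1.clog_real (hslit s hs)).congr_deriv ?_
    have h2 := sub_ne_zero.2 (hne s hs)
    have h3 := Complex.slitPlane_ne_zero (hslit s hs)
    rw [div_eq_div_iff h3 h2]
    field_simp
    linear_combination -(ε : ℂ) * c.tangent s * c.tangent t * hσ2
  rw [cauchy, intervalIntegral.integral_eq_sub_of_hasDerivAt hd
    (c.intervalIntegrable_cauchyKernel hne)]

theorem tendsto_log_add {w : ℂ} (hw : w.im ≠ 0) :
    Tendsto (fun ε : ℝ => Complex.log (w + ε)) (𝓝[>] 0) (𝓝 (Complex.log w)) := by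
  have h1 : Continuous fun ε : ℝ => w + ε := by fun_prop
  have h2 : Tendsto (fun ε : ℝ => w + (ε : ℂ)) (𝓝[>] 0) (𝓝 w) := by
    have := (h1.tendsto 0).mono_left (nhdsWithin_le_nhds (s := Ioi (0 : ℝ)))
    simpa using this
  exact (continuousAt_clog (Or.inr hw)).tendsto.comp h2

/-- The source of the jump: the two ends of the short piece each contribute one such `πi`. -/
theorem log_neg_of_im_pos {w : ℂ} (hw : 0 < w.im) :
    Complex.log (-w) = Complex.log w - Real.pi * Complex.I := by
  rw [Complex.log, Complex.log, norm_neg, Complex.arg_neg_eq_arg_sub_pi_of_im_pos hw]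
  push_cast
  ring

/-- The jump of the Cauchy integral across the curve. -/
theorem tendsto_cauchy_jump (c : CurveArc) {t : ℝ} (ht : t ∈ Ioo 0 c.length)
    (h₁ : ∀ᶠ ε : ℝ in 𝓝[>] 0, c.point t + ε * (Complex.I * c.tangent t) ∉ c.carrier)
    (h₂ : ∀ᶠ ε : ℝ in 𝓝[>] 0, c.point t + ε * -(Complex.I * c.tangent t) ∉ c.carrier) :
    Tendsto (fun ε : ℝ => c.cauchy 0 c.length (c.point t + ε * (Complex.I * c.tangent t)) -
      c.cauchy 0 c.length (c.point t + ε * -(Complex.I * c.tangent t))) (𝓝[>] 0)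
      (𝓝 (2 * Real.pi * Complex.I)) := by
  obtain ⟨δ₀, hδ₀, hm₀⟩ := c.exists_forward t
  -- The curve is cut into a short piece around `t`, where the integral is explicit, and two outer
  -- pieces that stay away from the point at `t`.
  obtain ⟨δ, hδ, hδle, hδ1, hδ2⟩ : ∃ δ > 0, δ ≤ δ₀ ∧ 0 < t - δ ∧ t + δ < c.length := by
    refine ⟨min δ₀ (min (t / 2) ((c.length - t) / 2)), ?_, min_le_left _ _, ?_, ?_⟩
    · exact lt_min hδ₀ (lt_min (by linarith [ht.1]) (by linarith [ht.2]))
    · have := (min_le_right δ₀ _).trans (min_le_left (t / 2) ((c.length - t) / 2))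
      linarith [ht.1]
    · have := (min_le_right δ₀ _).trans (min_le_right (t / 2) ((c.length - t) / 2))
      linarith [ht.2]
  have hm := hm₀.mono (Icc_subset_Icc (by linarith : t - δ₀ ≤ t - δ)
    (by linarith : t + δ ≤ t + δ₀))
  set w : ℝ → ℂ := fun s => (c.point s - c.point t) / c.tangent t with hw
  have hwt : (w t).re = 0 := by simp [hw]
  have htm : t ∈ Icc (t - δ) (t + δ) := ⟨by linarith, by linarith⟩
  have hwb : 0 < (w (t + δ)).re := by
    rw [← hwt]
    exact hm htm ⟨by linarith, le_rfl⟩ (by linarith)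
  have hwa : (w (t - δ)).re < 0 := by
    rw [← hwt]
    exact hm ⟨le_rfl, by linarith⟩ htm (by linarith)
  have hne : ∀ s ∈ Icc 0 c.length, s ≠ t → c.point s ≠ c.point t := fun s hs hst h =>
    hst (c.point_injOn hs (Ioo_subset_Icc_self ht) h)
  have hne1 : ∀ s ∈ uIcc 0 (t - δ), c.point s ≠ c.point t := by
    intro s hs
    rw [uIcc_of_le hδ1.le] at hs
    exact hne s ⟨hs.1, by linarith [hs.2]⟩ (by linarith [hs.2] : s < t).ne
  have hne2 : ∀ s ∈ uIcc (t + δ) c.length, c.point s ≠ c.point t := by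
    intro s hs
    rw [uIcc_of_le hδ2.le] at hs
    exact hne s ⟨by linarith [hs.1, ht.1], hs.2⟩ (by linarith [hs.1] : t < s).ne'
  have hsplit : ∀ z ∉ c.carrier, c.cauchy 0 c.length z =
      c.cauchy 0 (t - δ) z + c.cauchy (t - δ) (t + δ) z + c.cauchy (t + δ) c.length z := by
    intro z hz
    have hi : ∀ x ∈ Icc 0 c.length, ∀ y ∈ Icc 0 c.length, IntervalIntegrable
        (fun s => c.tangent s / (c.point s - z)) MeasureTheory.volume x y := by
      intro x hx y hy
      refine c.intervalIntegrable_cauchyKernel fun s hs h => hz ?_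
      rw [← h]
      exact c.point_mem_carrier (uIcc_subset_Icc hx hy hs)
    have ha : t - δ ∈ Icc 0 c.length := ⟨hδ1.le, by linarith⟩
    have hb : t + δ ∈ Icc 0 c.length := ⟨by linarith, hδ2.le⟩
    simp only [cauchy]
    rw [intervalIntegral.integral_add_adjacent_intervals (hi _ c.zero_mem _ ha) (hi _ ha _ hb),
      intervalIntegral.integral_add_adjacent_intervals (hi _ c.zero_mem _ hb)
        (hi _ hb _ c.length_mem)]
  have hlim : Tendsto (fun ε : ℝ =>
      (c.cauchy 0 (t - δ) (c.point t + ε * (Complex.I * c.tangent t)) +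
        (Complex.log (Complex.I * w (t + δ) + ε) - Complex.log (Complex.I * w (t - δ) + ε)) +
        c.cauchy (t + δ) c.length (c.point t + ε * (Complex.I * c.tangent t))) -
      (c.cauchy 0 (t - δ) (c.point t + ε * -(Complex.I * c.tangent t)) +
        (Complex.log (-Complex.I * w (t + δ) + ε) - Complex.log (-Complex.I * w (t - δ) + ε)) +
        c.cauchy (t + δ) c.length (c.point t + ε * -(Complex.I * c.tangent t))))
      (𝓝[>] 0) (𝓝
      ((c.cauchy 0 (t - δ) (c.point t) +
        (Complex.log (Complex.I * w (t + δ)) - Complex.log (Complex.I * w (t - δ))) +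
        c.cauchy (t + δ) c.length (c.point t)) -
      (c.cauchy 0 (t - δ) (c.point t) +
        (Complex.log (-Complex.I * w (t + δ)) - Complex.log (-Complex.I * w (t - δ))) +
        c.cauchy (t + δ) c.length (c.point t)))) := by
    refine ((((c.tendsto_cauchy_normal hne1 _).add ?_).add (c.tendsto_cauchy_normal hne2 _)).sub
      (((c.tendsto_cauchy_normal hne1 _).add ?_).add (c.tendsto_cauchy_normal hne2 _)))
    · refine (tendsto_log_add ?_).sub (tendsto_log_add ?_)
      · simpa using hwb.ne'
      · simpa using hwa.ne
    · refine (tendsto_log_add ?_).sub (tendsto_log_add ?_)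
      · simpa using hwb.ne'
      · simpa using hwa.ne
  have hval : 2 * Real.pi * Complex.I = ((c.cauchy 0 (t - δ) (c.point t) +
        (Complex.log (Complex.I * w (t + δ)) - Complex.log (Complex.I * w (t - δ))) +
        c.cauchy (t + δ) c.length (c.point t)) -
      (c.cauchy 0 (t - δ) (c.point t) +
        (Complex.log (-Complex.I * w (t + δ)) - Complex.log (-Complex.I * w (t - δ))) +
        c.cauchy (t + δ) c.length (c.point t))) := by
    have h1 : Complex.log (-Complex.I * w (t + δ)) =
        Complex.log (Complex.I * w (t + δ)) - Real.pi * Complex.I := by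
      rw [neg_mul]
      exact log_neg_of_im_pos (by simpa using hwb)
    have h2 : Complex.log (Complex.I * w (t - δ)) =
        Complex.log (-Complex.I * w (t - δ)) - Real.pi * Complex.I := by
      rw [← log_neg_of_im_pos (by simpa using hwa), neg_mul, neg_neg]
    rw [h1, h2]
    ring
  rw [hval]
  refine hlim.congr' ?_
  filter_upwards [h₁, h₂, self_mem_nhdsWithin] with ε hε1 hε2 hε
  rw [hsplit _ hε1, hsplit _ hε2, c.cauchy_normal_eq hδ hm (Or.inl rfl) hε,
    ← neg_mul, c.cauchy_normal_eq hδ hm (Or.inr rfl) hε]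

end CurveArc

/-! ### Pressures from balanced curvatures. -/

/-- The signed curvatures of the curves that leave any given point sum to zero. -/
def CurvatureBalance (S : Finset CurveArc) : Prop :=
  ∀ p : ℂ, ∑ c ∈ S, ((if c.point 0 = p then c.curvature else 0) -
    (if c.point c.length = p then c.curvature else 0)) = 0

/-- The sum of the Cauchy integrals of the curves, weighted with their curvatures. -/
noncomputable def cauchySum (S : Finset CurveArc) (z : ℂ) : ℂ :=
  ∑ c ∈ S, c.curvature * c.cauchy 0 c.length z

/-- Regrouped by vertices, the derivative has at `1 / (p - z)` exactly the sum of the signed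
curvatures leaving `p` as its coefficient. -/
theorem hasDerivAt_cauchySum {S : Finset CurveArc} (hS : CurvatureBalance S) {z : ℂ}
    (hz : z ∉ film S) : HasDerivAt (cauchySum S) 0 z := by
  have h1 : HasDerivAt (cauchySum S) (∑ c ∈ S, c.curvature *
      (1 / (c.point 0 - z) - 1 / (c.point c.length - z))) z := by
    refine HasDerivAt.fun_sum fun c hc => (c.hasDerivAt_cauchy ?_).const_mul _
    intro s hs h
    rw [uIcc_of_le c.length_pos.le] at hs
    exact hz (carrier_subset_film hc (h ▸ c.point_mem_carrier hs))
  refine h1.congr_deriv ?_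
  set V : Finset ℂ := S.image (fun c => c.point 0) ∪ S.image (fun c => c.point c.length) with hV
  have h2 : ∀ c ∈ S, (c.curvature : ℂ) * (1 / (c.point 0 - z) - 1 / (c.point c.length - z)) =
      ∑ p ∈ V, ((((if c.point 0 = p then c.curvature else 0) -
        (if c.point c.length = p then c.curvature else 0) : ℝ)) : ℂ) * (1 / (p - z)) := by
    intro c hc
    have ha : c.point 0 ∈ V := Finset.mem_union_left _ (Finset.mem_image_of_mem _ hc)
    have hb : c.point c.length ∈ V := Finset.mem_union_right _
      (Finset.mem_image_of_mem (fun c : CurveArc => c.point c.length) hc)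
    simp only [Complex.ofReal_sub, sub_mul, Finset.sum_sub_distrib, apply_ite Complex.ofReal,
      Complex.ofReal_zero, ite_mul, zero_mul, Finset.sum_ite_eq, ha, hb, if_true, mul_sub]
  rw [Finset.sum_congr rfl h2, Finset.sum_comm]
  refine Finset.sum_eq_zero fun p _ => ?_
  rw [← Finset.sum_mul, ← Complex.ofReal_sum, hS p, Complex.ofReal_zero, zero_mul]

theorem IsBubble.isOpen {S : Finset CurveArc} {W : Set ℂ} (hW : IsBubble S W) : IsOpen W := by
  obtain ⟨z, -, rfl⟩ := hW
  exact (isCompact_film S).isClosed.isOpen_compl.connectedComponentIn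

theorem IsBubble.isPreconnected {S : Finset CurveArc} {W : Set ℂ} (hW : IsBubble S W) :
    IsPreconnected W := by
  obtain ⟨z, -, rfl⟩ := hW
  exact isPreconnected_connectedComponentIn

theorem IsBubble.subset_compl {S : Finset CurveArc} {W : Set ℂ} (hW : IsBubble S W) :
    W ⊆ (film S)ᶜ := by
  obtain ⟨z, -, rfl⟩ := hW
  exact connectedComponentIn_subset _ _

/-- Curves that obey Plateau's laws and whose curvatures balance at the endpoints have pressures. -/
theorem exists_youngLaplace {S : Finset CurveArc} (hP : PlateauLaws S) (hS : CurvatureBalance S) :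
    ∃ P : Set ℂ → ℝ, YoungLaplace S 1 P := by
  classical
  -- The sum is constant on a bubble, so the chosen point is immaterial; the value `0` for the empty
  -- set plays no role, because pressures are compared only at points of bubbles.
  set P : Set ℂ → ℝ := fun W =>
    if h : W.Nonempty then (cauchySum S h.some / (2 * Real.pi * Complex.I)).re else 0 with hPdef
  have hval : ∀ W, IsBubble S W → ∀ z ∈ W,
      P W = (cauchySum S z / (2 * Real.pi * Complex.I)).re := by
    intro W hW z hz
    have hne : W.Nonempty := ⟨z, hz⟩
    have hconst : cauchySum S hne.some = cauchySum S z := by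
      refine hW.isOpen.is_const_of_deriv_eq_zero hW.isPreconnected ?_ ?_ hne.some_mem hz
      · exact fun x hx => (hasDerivAt_cauchySum hS
          (hW.subset_compl hx)).differentiableAt.differentiableWithinAt
      · exact fun x hx => (hasDerivAt_cauchySum hS (hW.subset_compl hx)).deriv
    rw [hPdef]
    simp only [dif_pos hne, hconst]
  refine ⟨P, fun c hc t ht W W' hW hW' h h' => ?_⟩
  -- Only `c` itself passes through this point, so the other curves add continuous terms and the
  -- jump comes from `c` alone.
  have hoff : ∀ d ∈ S, d ≠ c → ∀ s ∈ uIcc 0 d.length, d.point s ≠ c.point t := by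
    intro d hd hdc s hs hst
    rw [uIcc_of_le d.length_pos.le] at hs
    exact c.not_isEndpoint ht (hP.noncrossing d hd c hc hdc _
      ⟨hst ▸ d.point_mem_carrier hs, c.point_mem_carrier (Ioo_subset_Icc_self ht)⟩).2
  have hlim : Tendsto (fun ε : ℝ => cauchySum S (c.point t + ε * (Complex.I * c.tangent t)) -
      cauchySum S (c.point t + ε * -(Complex.I * c.tangent t))) (𝓝[>] 0)
      (𝓝 (c.curvature * (2 * Real.pi * Complex.I))) := by
    have h3 : ∀ d ∈ S, Tendsto (fun ε : ℝ => (d.curvature : ℂ) *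
        (d.cauchy 0 d.length (c.point t + ε * (Complex.I * c.tangent t)) -
        d.cauchy 0 d.length (c.point t + ε * -(Complex.I * c.tangent t)))) (𝓝[>] 0)
        (𝓝 (if d = c then d.curvature * (2 * Real.pi * Complex.I) else 0)) := by
      intro d hd
      refine Tendsto.congr (fun _ => rfl) ?_
      split_ifs with hdc
      · subst hdc
        refine (d.tendsto_cauchy_jump ht ?_ ?_).const_mul _
        · filter_upwards [h] with ε hε hmem
          exact hW.subset_compl hε (carrier_subset_film hd hmem)
        · filter_upwards [h'] with ε hε hmem
          exact hW'.subset_compl hε (carrier_subset_film hd hmem)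
      · have := ((d.tendsto_cauchy_normal (hoff d hd hdc) (Complex.I * c.tangent t)).sub
          (d.tendsto_cauchy_normal (hoff d hd hdc) (-(Complex.I * c.tangent t)))).const_mul
          (d.curvature : ℂ)
        simpa using this
    have h4 := tendsto_finsetSum S h3
    rw [Finset.sum_ite_eq' S c, if_pos hc] at h4
    refine h4.congr fun ε => ?_
    simp only [cauchySum, mul_sub, Finset.sum_sub_distrib]
  have hpi : (2 * Real.pi * Complex.I : ℂ) ≠ 0 := Complex.two_pi_I_ne_zero
  have hlim2 := (Complex.continuous_re.tendsto _).comp (hlim.div_const (2 * Real.pi * Complex.I))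
  rw [mul_div_cancel_right₀ _ hpi, Complex.ofReal_re] at hlim2
  rw [one_mul]
  refine tendsto_nhds_unique (tendsto_const_nhds (f := 𝓝[>] (0 : ℝ))) (hlim2.congr' ?_)
  filter_upwards [h, h'] with ε hε hε'
  rw [hval W hW _ hε, hval W' hW' _ hε', Function.comp, sub_div, Complex.sub_re]

/-! ### The three curves at a vertex. -/

/-- The rotation by a third of a full turn. -/
noncomputable def thirdTurn : ℂ := Complex.exp ((2 * Real.pi / 3 : ℝ) * Complex.I)

theorem cos_two_pi_div_three : Real.cos (2 * Real.pi / 3) = -(1 / 2) := by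
  rw [show 2 * Real.pi / 3 = Real.pi - Real.pi / 3 by ring, Real.cos_pi_sub, Real.cos_pi_div_three]

theorem sin_two_pi_div_three : Real.sin (2 * Real.pi / 3) = √3 / 2 := by
  rw [show 2 * Real.pi / 3 = Real.pi - Real.pi / 3 by ring, Real.sin_pi_sub, Real.sin_pi_div_three]

theorem thirdTurn_re : thirdTurn.re = -(1 / 2) := by
  rw [thirdTurn, Complex.exp_ofReal_mul_I_re, cos_two_pi_div_three]

theorem thirdTurn_im : thirdTurn.im = √3 / 2 := by
  rw [thirdTurn, Complex.exp_ofReal_mul_I_im, sin_two_pi_div_three]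

theorem thirdTurn_sq : thirdTurn * thirdTurn = -1 - thirdTurn := by
  have h : √3 * √3 = 3 := Real.mul_self_sqrt (by norm_num)
  apply Complex.ext
  · simp only [Complex.mul_re, Complex.sub_re, Complex.neg_re, Complex.one_re, thirdTurn_re,
      thirdTurn_im]
    linarith
  · simp only [Complex.mul_im, Complex.sub_im, Complex.neg_im, Complex.one_im, thirdTurn_re,
      thirdTurn_im]
    ring

theorem thirdTurn_cube : thirdTurn * thirdTurn * thirdTurn = 1 := by
  linear_combination (thirdTurn - 1) * thirdTurn_sq

theorem re_conj_mul_of_angle_eq {v w : ℂ} (hv : ‖v‖ = 1) (hw : ‖w‖ = 1)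
    (h : InnerProductGeometry.angle v w = 2 * Real.pi / 3) :
    v.re * w.re + v.im * w.im = -(1 / 2) := by
  have h1 := InnerProductGeometry.cos_angle v w
  rw [h, cos_two_pi_div_three, hv, hw, Complex.inner] at h1
  simp at h1
  linarith

/-- Three unit vectors that form angles of `2π/3` are rotated into one another by third turns. -/
theorem eq_thirdTurn_of_angles {v₁ v₂ v₃ : ℂ} (h₁ : ‖v₁‖ = 1) (h₂ : ‖v₂‖ = 1) (h₃ : ‖v₃‖ = 1)
    (h₁₂ : InnerProductGeometry.angle v₁ v₂ = 2 * Real.pi / 3)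
    (h₁₃ : InnerProductGeometry.angle v₁ v₃ = 2 * Real.pi / 3)
    (h₂₃ : InnerProductGeometry.angle v₂ v₃ = 2 * Real.pi / 3) :
    (v₂ = v₁ * thirdTurn ∧ v₃ = v₂ * thirdTurn) ∨
      (v₃ = v₁ * thirdTurn ∧ v₂ = v₃ * thirdTurn) := by
  have e12 := re_conj_mul_of_angle_eq h₁ h₂ h₁₂
  have e13 := re_conj_mul_of_angle_eq h₁ h₃ h₁₃
  have e23 := re_conj_mul_of_angle_eq h₂ h₃ h₂₃
  have n1 : v₁.re * v₁.re + v₁.im * v₁.im = 1 := by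
    rw [← Complex.normSq_apply, Complex.normSq_eq_norm_sq, h₁, one_pow]
  have n2 : v₂.re * v₂.re + v₂.im * v₂.im = 1 := by
    rw [← Complex.normSq_apply, Complex.normSq_eq_norm_sq, h₂, one_pow]
  have n3 : v₃.re * v₃.re + v₃.im * v₃.im = 1 := by
    rw [← Complex.normSq_apply, Complex.normSq_eq_norm_sq, h₃, one_pow]
  -- The squared norm of the sum is `3 + 6 * (-1/2) = 0`.
  have hsum : v₁ + v₂ + v₃ = 0 := by
    rw [← Complex.normSq_eq_zero, Complex.normSq_apply]
    simp only [Complex.add_re, Complex.add_im]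
    linarith
  have h3 : √3 * √3 = 3 := Real.mul_self_sqrt (by norm_num)
  -- The cross product of `v₁` and `v₂` is `±√3/2`; its sign decides the cyclic order of the three
  -- vectors.
  have hy : (v₁.re * v₂.im - v₁.im * v₂.re) * (v₁.re * v₂.im - v₁.im * v₂.re) =
      (√3 / 2) * (√3 / 2) := by
    have : (v₁.re * v₂.re + v₁.im * v₂.im) ^ 2 + (v₁.re * v₂.im - v₁.im * v₂.re) ^ 2 =
      (v₁.re * v₁.re + v₁.im * v₁.im) * (v₂.re * v₂.re + v₂.im * v₂.im) := by ring
    rw [e12, n1, n2] at this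
    linarith
  have hv3 : v₃ = -v₁ - v₂ := by linear_combination hsum
  have hre : v₂.re = v₁.re * (v₁.re * v₂.re + v₁.im * v₂.im) -
      v₁.im * (v₁.re * v₂.im - v₁.im * v₂.re) := by linear_combination -v₂.re * n1
  have him : v₂.im = v₁.re * (v₁.re * v₂.im - v₁.im * v₂.re) +
      v₁.im * (v₁.re * v₂.re + v₁.im * v₂.im) := by linear_combination -v₂.im * n1
  rw [e12] at hre him
  rcases mul_self_eq_mul_self_iff.1 hy with hy | hy
  · left
    have h2 : v₂ = v₁ * thirdTurn := by
      apply Complex.ext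
      · rw [Complex.mul_re, thirdTurn_re, thirdTurn_im, hre, hy]
      · rw [Complex.mul_im, thirdTurn_re, thirdTurn_im, him, hy]
    refine ⟨h2, ?_⟩
    rw [hv3, h2]
    linear_combination -v₁ * thirdTurn_sq
  · right
    have h2 : v₃ = v₁ * thirdTurn := by
      rw [hv3]
      apply Complex.ext
      · rw [Complex.mul_re, thirdTurn_re, thirdTurn_im, Complex.sub_re, Complex.neg_re, hre, hy]
        ring
      · rw [Complex.mul_im, thirdTurn_re, thirdTurn_im, Complex.sub_im, Complex.neg_im, him, hy]
        ring
    refine ⟨h2, ?_⟩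
    have h2' : v₂ = -v₁ - v₃ := by linear_combination hsum
    rw [h2', h2]
    linear_combination -v₁ * thirdTurn_sq

namespace CurveArc

/-- At an endpoint a curve, or its reverse, starts. -/
theorem IsEndpoint.exists_outgoing {c : CurveArc} {p : ℂ} (h : c.IsEndpoint p) :
    ∃ e : CurveArc, (e = c ∨ e = c.reverse) ∧ e.base = p ∧ c.LeavesFrom p e.dir ∧
      ((if c.point 0 = p then c.curvature else 0) -
        (if c.point c.length = p then c.curvature else 0)) = e.curvature ∧
      ((if c.point 0 = p then c.tangent 0 else 0) -
        (if c.point c.length = p then c.tangent c.length else 0)) = e.dir := by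
  rcases h with rfl | rfl
  · exact ⟨c, Or.inl rfl, c.point_zero.symm, Or.inl ⟨rfl, c.tangent_zero.symm⟩,
      by simp [-point_zero, c.point_zero_ne_point_length.symm],
      by simp [-point_zero, c.point_zero_ne_point_length.symm]⟩
  · exact ⟨c.reverse, Or.inr rfl, rfl, Or.inr ⟨rfl, rfl⟩,
      by simp [-point_zero, c.point_zero_ne_point_length, reverse],
      by simp [-point_zero, c.point_zero_ne_point_length, reverse]⟩

theorem carrier_eq_of_eq_or_reverse {c e : CurveArc} (h : e = c ∨ e = c.reverse) :
    e.carrier = c.carrier := by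
  rcases h with rfl | rfl
  · rfl
  · exact c.reverse_carrier

end CurveArc

/-- The local structure of a cluster at an endpoint: three curves leave it. -/
theorem PlateauLaws.exists_junction {S : Finset CurveArc} (hS : PlateauLaws S) {c : CurveArc}
    (hc : c ∈ S) {p : ℂ} (hp : c.IsEndpoint p) :
    ∃ e₁ e₂ e₃ : CurveArc, (e₁.base = p ∧ e₂.base = p ∧ e₃.base = p) ∧
      (e₂.dir = e₁.dir * thirdTurn ∧ e₃.dir = e₂.dir * thirdTurn) ∧
      ((∃ d ∈ S, e₁ = d ∨ e₁ = d.reverse) ∧ (∃ d ∈ S, e₂ = d ∨ e₂ = d.reverse) ∧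
        (∃ d ∈ S, e₃ = d ∨ e₃ = d.reverse)) ∧
      (∀ d ∈ S, p ∈ d.carrier →
        d.carrier = e₁.carrier ∨ d.carrier = e₂.carrier ∨ d.carrier = e₃.carrier) ∧
      (∑ d ∈ S, ((if d.point 0 = p then d.curvature else 0) -
        (if d.point d.length = p then d.curvature else 0)) =
          e₁.curvature + e₂.curvature + e₃.curvature) ∧
      (∑ d ∈ S, ((if d.point 0 = p then d.tangent 0 else 0) -
        (if d.point d.length = p then d.tangent d.length else 0)) =
          e₁.dir + e₂.dir + e₃.dir) := by
  classical
  obtain ⟨d₁, d₂, d₃, h12, h13, h23, hset⟩ := Set.ncard_eq_three.1 (hS.three_meet c hc p hp)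
  have hmem : ∀ d, d ∈ S ∧ p ∈ d.carrier ↔ d = d₁ ∨ d = d₂ ∨ d = d₃ := by
    intro d
    simpa using Set.ext_iff.1 hset d
  have m1 := (hmem d₁).2 (Or.inl rfl)
  have m2 := (hmem d₂).2 (Or.inr (Or.inl rfl))
  have m3 := (hmem d₃).2 (Or.inr (Or.inr rfl))
  have p1 : d₁.IsEndpoint p := (hS.noncrossing d₁ m1.1 d₂ m2.1 h12 p ⟨m1.2, m2.2⟩).1
  have p2 : d₂.IsEndpoint p := (hS.noncrossing d₁ m1.1 d₂ m2.1 h12 p ⟨m1.2, m2.2⟩).2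
  have p3 : d₃.IsEndpoint p := (hS.noncrossing d₁ m1.1 d₃ m3.1 h13 p ⟨m1.2, m3.2⟩).2
  obtain ⟨e₁, r1, b1, l1, k1, t1⟩ := p1.exists_outgoing
  obtain ⟨e₂, r2, b2, l2, k2, t2⟩ := p2.exists_outgoing
  obtain ⟨e₃, r3, b3, l3, k3, t3⟩ := p3.exists_outgoing
  -- The target group is left open because the same reduction to three terms serves the real
  -- curvatures and the complex tangents.
  have hsum : ∀ {E : Type} [AddCommGroup E] (a b : CurveArc → E),
      ∑ d ∈ S, ((if d.point 0 = p then a d else 0) - (if d.point d.length = p then b d else 0)) =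
      ((if d₁.point 0 = p then a d₁ else 0) - (if d₁.point d₁.length = p then b d₁ else 0)) +
      ((if d₂.point 0 = p then a d₂ else 0) - (if d₂.point d₂.length = p then b d₂ else 0)) +
      ((if d₃.point 0 = p then a d₃ else 0) - (if d₃.point d₃.length = p then b d₃ else 0)) := by
    intro E _ a b
    have hsub : ({d₁, d₂, d₃} : Finset CurveArc) ⊆ S := by
      intro d hd
      simp only [Finset.mem_insert, Finset.mem_singleton] at hd
      exact ((hmem d).2 hd).1
    rw [← Finset.sum_subset hsub, Finset.sum_insert (by simp [h12, h13]),
      Finset.sum_insert (by simp [h23]), Finset.sum_singleton, add_assoc]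
    intro d hd hd'
    have hnp : p ∉ d.carrier := by
      intro h
      apply hd'
      simpa using (hmem d).1 ⟨hd, h⟩
    rw [if_neg, if_neg, sub_zero]
    · rintro rfl
      exact hnp (d.point_mem_carrier d.length_mem)
    · rintro rfl
      exact hnp (d.point_mem_carrier d.zero_mem)
  have hcar : ∀ d ∈ S, p ∈ d.carrier →
      d.carrier = e₁.carrier ∨ d.carrier = e₂.carrier ∨ d.carrier = e₃.carrier := by
    intro d hd hpd
    rw [CurveArc.carrier_eq_of_eq_or_reverse r1, CurveArc.carrier_eq_of_eq_or_reverse r2,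
      CurveArc.carrier_eq_of_eq_or_reverse r3]
    rcases (hmem d).1 ⟨hd, hpd⟩ with rfl | rfl | rfl <;> simp
  have hk := hsum (fun d => d.curvature) (fun d => d.curvature)
  have ht := hsum (fun d => d.tangent 0) (fun d => d.tangent d.length)
  rw [k1, k2, k3] at hk
  rw [t1, t2, t3] at ht
  rcases eq_thirdTurn_of_angles e₁.norm_dir e₂.norm_dir e₃.norm_dir
    (hS.angle_eq d₁ m1.1 d₂ m2.1 h12 p _ _ l1 l2) (hS.angle_eq d₁ m1.1 d₃ m3.1 h13 p _ _ l1 l3)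
    (hS.angle_eq d₂ m2.1 d₃ m3.1 h23 p _ _ l2 l3) with h | h
  · exact ⟨e₁, e₂, e₃, ⟨b1, b2, b3⟩, h, ⟨⟨d₁, m1.1, r1⟩, ⟨d₂, m2.1, r2⟩, ⟨d₃, m3.1, r3⟩⟩,
      hcar, hk, ht⟩
  -- In the other cyclic order the second and third curves are exchanged, so that the listing is
  -- always counterclockwise.
  · refine ⟨e₁, e₃, e₂, ⟨b1, b3, b2⟩, h, ⟨⟨d₁, m1.1, r1⟩, ⟨d₃, m3.1, r3⟩, ⟨d₂, m2.1, r2⟩⟩,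
      fun d hd hpd => (hcar d hd hpd).imp_right Or.symm, ?_, ?_⟩
    · rw [hk]
      ring
    · rw [ht]
      ring

/-- The tangents that leave any given point sum to zero. -/
theorem PlateauLaws.tangentBalance {S : Finset CurveArc} (hS : PlateauLaws S) (p : ℂ) :
    ∑ d ∈ S, ((if d.point 0 = p then d.tangent 0 else 0) -
        (if d.point d.length = p then d.tangent d.length else 0)) = 0 := by
  by_cases h : ∃ c ∈ S, c.IsEndpoint p
  · obtain ⟨c, hc, hp⟩ := h
    obtain ⟨e₁, e₂, e₃, -, ⟨h2, h3⟩, -, -, -, hsum⟩ := hS.exists_junction hc hp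
    rw [hsum, h3, h2]
    linear_combination e₁.dir * thirdTurn_sq
  · push Not at h
    refine Finset.sum_eq_zero fun c hc => ?_
    rw [if_neg fun h' => h c hc (Or.inl h'.symm), if_neg fun h' => h c hc (Or.inr h'.symm),
      sub_zero]

/-! ### Balanced curvatures from pressures: sectors and bubbles at a vertex. -/

/-- The Young--Laplace equation in the form that also covers reversed curves. -/
theorem YoungLaplace.outgoing {S : Finset CurveArc} {γ : ℝ} {P : Set ℂ → ℝ}
    (h : YoungLaplace S γ P) {e : CurveArc} (he : ∃ d ∈ S, e = d ∨ e = d.reverse) {t : ℝ}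
    (ht : t ∈ Ioo 0 e.length) {W W' : Set ℂ} (hW : IsBubble S W) (hW' : IsBubble S W')
    (hl : LiesOnSide W (e.point t) (Complex.I * e.tangent t))
    (hr : LiesOnSide W' (e.point t) (-(Complex.I * e.tangent t))) :
    P W - P W' = γ * e.curvature := by
  obtain ⟨d, hd, rfl | rfl⟩ := he
  · exact h e hd t ht W W' hW hW' hl hr
  · rw [CurveArc.reverse_point, CurveArc.reverse_tangent, mul_neg] at hl hr
    rw [neg_neg] at hr
    have := h d hd (d.length - t) ⟨sub_pos.2 ht.2, by linarith [ht.1]⟩ W' W hW' hW hr hl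
    rw [show d.reverse.curvature = -d.curvature from rfl]
    linarith

namespace CurveArc

/-- The points of the circle that contains a curve, in front of its starting point. -/
def AheadOn (e : CurveArc) (z : ℂ) : Prop :=
  0 < ((z - e.base) / e.dir).re ∧
    2 * ((z - e.base) / e.dir).im = e.curvature * Complex.normSq (z - e.base)

theorem exists_re_pos (e : CurveArc) : ∃ δ > 0, ∀ t, 0 < t → t ≤ δ →
    0 < ((e.point t - e.base) / e.dir).re := by
  obtain ⟨δ, hδ, hm⟩ := e.exists_forward 0
  refine ⟨δ, hδ, fun t h0 h1 => ?_⟩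
  have := hm ⟨by linarith, by linarith⟩ ⟨by linarith, by linarith⟩ h0
  simpa using this

theorem im_outgoing (e : CurveArc) (t : ℝ) : 2 * ((e.point t - e.base) / e.dir).im =
    e.curvature * Complex.normSq (e.point t - e.base) := by
  simpa using e.im_chord 0 t

theorem eventually_aheadOn (e : CurveArc) :
    ∀ᶠ z in 𝓝 e.base, z ∈ e.carrier → z = e.base ∨ e.AheadOn z := by
  obtain ⟨δ, hδ, hre⟩ := e.exists_re_pos
  have hK : IsClosed (e.point '' (Icc δ e.length)) :=
    (isCompact_Icc.image e.continuous_point).isClosed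
  have hb : e.base ∈ (e.point '' (Icc δ e.length))ᶜ := by
    rintro ⟨t, ht, h⟩
    rw [← e.point_zero] at h
    have := e.point_injOn ⟨by linarith [ht.1], ht.2⟩ e.zero_mem h
    linarith [ht.1]
  filter_upwards [hK.isOpen_compl.mem_nhds hb] with z hz hzc
  obtain ⟨t, ht, rfl⟩ := hzc
  rcases ht.1.eq_or_lt with rfl | h0
  · exact Or.inl e.point_zero
  · refine Or.inr ⟨hre t h0 ?_, e.im_outgoing t⟩
    by_contra h
    exact hz ⟨t, ⟨(not_le.1 h).le, ht.2⟩, rfl⟩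

/-- The position relative to the circle of a curve of a point on the normal to the curve. -/
theorem normal_offset (e : CurveArc) (t ε : ℝ) :
    2 * ((e.point t + ε * (Complex.I * e.tangent t) - e.base) / e.dir).im -
      e.curvature * Complex.normSq (e.point t + ε * (Complex.I * e.tangent t) - e.base) =
      2 * ε - e.curvature * ε ^ 2 := by
  have hd := e.dir_ne_zero
  set u := (e.point t - e.base) / e.dir with hu
  have h1 := e.im_outgoing t
  -- In the frame of the starting point, moving by `ε` along the normal sends `u` to `(1 - κε) u +
  -- iε`, whence the factor `(1 - κε)²` at the end.
  have h2 : e.point t + ε * (Complex.I * e.tangent t) - e.base =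
      e.dir * (u + ε * Complex.I * (1 + Complex.I * e.curvature * u)) := by
    have h3 := e.tangent_sub_tangent 0 t
    rw [e.tangent_zero, e.point_zero] at h3
    have h4 : e.tangent t = e.dir * (1 + Complex.I * e.curvature * u) := by
      rw [hu]
      field_simp
      linear_combination h3
    have h5 : e.point t - e.base = e.dir * u := by
      rw [hu]
      field_simp
    rw [h4]
    linear_combination h5
  have hn : Complex.normSq e.dir = 1 := by
    rw [Complex.normSq_eq_norm_sq, e.norm_dir, one_pow]
  have h6 : e.point t - e.base = e.dir * u := by
    rw [hu]
    field_simp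
  rw [h6, map_mul, hn, one_mul, mul_div_cancel_left₀ _ hd, Complex.normSq_apply] at h1
  rw [h2, map_mul, hn, one_mul, mul_div_cancel_left₀ _ hd, Complex.normSq_apply]
  simp
  linear_combination (1 - 2 * ε * e.curvature + e.curvature ^ 2 * ε ^ 2) * h1

end CurveArc

/-- The region between two circular arcs of curvatures `k` and `k'` that leave `p` in the
direction `v` and in the direction obtained from it by a third turn. -/
def sector (p v : ℂ) (k k' r : ℝ) : Set ℂ :=
  {z | ∃ ρ θ : ℝ, 0 < ρ ∧ ρ < r ∧ Real.arcsin (k * ρ / 2) < θ ∧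
    θ < 2 * Real.pi / 3 + Real.arcsin (k' * ρ / 2) ∧
    z = p + v * (ρ * Complex.exp (θ * Complex.I))}

/-- Within a radius `r` such that `|k| * r ≤ 1`, an arc deviates from its initial direction by less
than `π/6`, so the opening `2π/3` of a sector cannot close up. -/
theorem abs_arcsin_lt {x : ℝ} (hx : |x| < 1 / 2) :
    -(Real.pi / 6) < Real.arcsin x ∧ Real.arcsin x < Real.pi / 6 := by
  have hpi := Real.pi_pos
  rw [abs_lt] at hx
  constructor
  · rw [Real.lt_arcsin_iff_sin_lt' ⟨by linarith, by linarith⟩, Real.sin_neg, Real.sin_pi_div_six]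
    exact hx.1
  · rw [Real.arcsin_lt_iff_lt_sin' ⟨by linarith, by linarith⟩, Real.sin_pi_div_six]
    exact hx.2

theorem abs_mul_half_lt {k r ρ : ℝ} (hk : |k| * r ≤ 1) (h0 : 0 < ρ) (hr : ρ < r) :
    |k * ρ / 2| < 1 / 2 := by
  rw [abs_div, abs_mul, abs_of_pos h0, abs_of_pos (two_pos : (0 : ℝ) < 2)]
  have : |k| * ρ < 1 := by
    rcases (abs_nonneg k).eq_or_lt with h | h
    · rw [← h, zero_mul]
      exact one_pos
    · nlinarith
  linarith

/-- The radius and the relative position between the two bounding angles exhibit the sector as a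
continuous image of a rectangle. -/
theorem isPreconnected_sector (p v : ℂ) {k k' r : ℝ} (hk : |k| * r ≤ 1) (hk' : |k'| * r ≤ 1) :
    IsPreconnected (sector p v k k' r) := by
  have himg : sector p v k k' r = (fun x : ℝ × ℝ => p + v * (x.1 * Complex.exp
      ((((1 - x.2) * Real.arcsin (k * x.1 / 2) +
        x.2 * (2 * Real.pi / 3 + Real.arcsin (k' * x.1 / 2)) : ℝ) : ℂ) * Complex.I))) ''
      (Ioo 0 r ×ˢ Ioo 0 1) := by
    ext z
    constructor
    · rintro ⟨ρ, θ, h0, hr, h1, h2, rfl⟩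
      set a := Real.arcsin (k * ρ / 2)
      set b := 2 * Real.pi / 3 + Real.arcsin (k' * ρ / 2)
      have hab : 0 < b - a := by linarith
      refine ⟨(ρ, (θ - a) / (b - a)), ⟨⟨h0, hr⟩, div_pos (by linarith) hab,
        (div_lt_one hab).2 (by linarith)⟩, ?_⟩
      have : (1 - (θ - a) / (b - a)) * a + (θ - a) / (b - a) * b = θ := by
        field_simp
        ring
      change p + v * (ρ * Complex.exp ((((1 - (θ - a) / (b - a)) * a +
        (θ - a) / (b - a) * b : ℝ) : ℂ) * Complex.I)) = _
      rw [this]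
    · rintro ⟨⟨ρ, s⟩, ⟨⟨h0, hr⟩, hs0, hs1⟩, rfl⟩
      have ha := abs_arcsin_lt (abs_mul_half_lt hk h0 hr)
      have hb := abs_arcsin_lt (abs_mul_half_lt hk' h0 hr)
      have hpi := Real.pi_pos
      refine ⟨ρ, _, h0, hr, ?_, ?_, rfl⟩
      · simp only at *
        nlinarith
      · simp only at *
        nlinarith
  rw [himg]
  refine ((convex_Ioo 0 r).prod (convex_Ioo 0 1)).isPreconnected.image _ ?_
  have h1 : Continuous Real.arcsin := Real.continuous_arcsin
  fun_prop

/-- In polar coordinates a circle of curvature `k` tangent to the real axis at the origin is `sin θ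
= kρ/2`; the positive real part selects the branch given by `arcsin`. -/
theorem eq_arcsin_of_ahead {ρ θ k : ℝ} (h0 : 0 < ρ) (hθ : -Real.pi ≤ θ) (hθ' : θ ≤ Real.pi)
    (hre : 0 < (ρ * Complex.exp (θ * Complex.I)).re)
    (him : 2 * (ρ * Complex.exp (θ * Complex.I)).im = k * ρ ^ 2) :
    θ = Real.arcsin (k * ρ / 2) := by
  rw [Complex.re_ofReal_mul, Complex.exp_ofReal_mul_I_re] at hre
  rw [Complex.im_ofReal_mul, Complex.exp_ofReal_mul_I_im] at him
  have hc : 0 < Real.cos θ := pos_of_mul_pos_right hre h0.le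
  have hs : Real.sin θ = k * ρ / 2 := by
    apply mul_left_cancel₀ h0.ne'
    linarith
  have hlo : -(Real.pi / 2) ≤ θ := by
    by_contra h
    push Not at h
    have := Real.cos_nonpos_of_pi_div_two_le_of_le (x := -θ) (by linarith) (by linarith)
    rw [Real.cos_neg] at this
    linarith
  have hhi : θ ≤ Real.pi / 2 := by
    by_contra h
    push Not at h
    have := Real.cos_nonpos_of_pi_div_two_le_of_le (x := θ) (by linarith) (by linarith)
    linarith
  rw [← hs, Real.arcsin_sin hlo hhi]

theorem exp_sub_mul_thirdTurn (θ : ℝ) : Complex.exp (θ * Complex.I) =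
    thirdTurn * Complex.exp ((θ - 2 * Real.pi / 3 : ℝ) * Complex.I) := by
  rw [thirdTurn, ← Complex.exp_add]
  congr 1
  push_cast
  ring

theorem normSq_polar {v : ℂ} (hv : ‖v‖ = 1) {ρ : ℝ} (θ : ℝ) :
    Complex.normSq (v * (ρ * Complex.exp (θ * Complex.I))) = ρ ^ 2 := by
  rw [Complex.normSq_eq_norm_sq, norm_mul, norm_mul, hv, Complex.norm_exp_ofReal_mul_I,
    Complex.norm_real, one_mul, mul_one, Real.norm_eq_abs, sq_abs]

/-- The sector between two of the curves that meet at a point contains no points of the curves. -/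
theorem not_aheadOn_of_mem_sector {p : ℂ} {e₁ e₂ e₃ : CurveArc} (h₁ : e₁.base = p)
    (h₂ : e₂.base = p) (h₃ : e₃.base = p) (d₂ : e₂.dir = e₁.dir * thirdTurn)
    (d₃ : e₃.dir = e₂.dir * thirdTurn) {r : ℝ} (hk : |e₁.curvature| * r ≤ 1)
    (hk' : |e₂.curvature| * r ≤ 1) {z : ℂ}
    (hz : z ∈ sector p e₁.dir e₁.curvature e₂.curvature r) :
    z ≠ p ∧ ¬ e₁.AheadOn z ∧ ¬ e₂.AheadOn z ∧ ¬ e₃.AheadOn z := by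
  obtain ⟨ρ, θ, h0, hr, ha, hb, rfl⟩ := hz
  have hpi := Real.pi_pos
  have ha' := abs_arcsin_lt (abs_mul_half_lt hk h0 hr)
  have hb' := abs_arcsin_lt (abs_mul_half_lt hk' h0 hr)
  have hd1 := e₁.dir_ne_zero
  have hd2 := e₂.dir_ne_zero
  have hd3 := e₃.dir_ne_zero
  have hρ : (ρ : ℂ) ≠ 0 := by exact_mod_cast h0.ne'
  refine ⟨?_, ?_, ?_, ?_⟩
  · intro h
    have h' : e₁.dir * (ρ * Complex.exp (θ * Complex.I)) = 0 := by linear_combination h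
    exact mul_ne_zero hd1 (mul_ne_zero hρ (Complex.exp_ne_zero _)) h'
  · rintro ⟨hre, him⟩
    rw [h₁, add_sub_cancel_left, mul_div_cancel_left₀ _ hd1] at hre him
    rw [normSq_polar e₁.norm_dir] at him
    have := eq_arcsin_of_ahead h0 (by linarith) (by linarith) hre him
    linarith
  · rintro ⟨hre, him⟩
    have he : e₁.dir * (ρ * Complex.exp (θ * Complex.I)) =
        e₂.dir * (ρ * Complex.exp ((θ - 2 * Real.pi / 3 : ℝ) * Complex.I)) := by
      rw [exp_sub_mul_thirdTurn θ, d₂]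
      ring
    rw [h₂, add_sub_cancel_left, he, mul_div_cancel_left₀ _ hd2] at hre him
    rw [normSq_polar e₂.norm_dir] at him
    have := eq_arcsin_of_ahead h0 (by linarith) (by linarith) hre him
    linarith
  -- Seen from `e₃` the angle is `θ - 4π/3`, which lies between `-3π/2` and `-π/2`: the sector is
  -- entirely behind the third curve.
  · rintro ⟨hre, -⟩
    have he : e₁.dir * (ρ * Complex.exp (θ * Complex.I)) =
        e₃.dir * (ρ * Complex.exp ((θ - 2 * Real.pi / 3 - 2 * Real.pi / 3 : ℝ) * Complex.I)) := by
      rw [exp_sub_mul_thirdTurn θ, exp_sub_mul_thirdTurn (θ - 2 * Real.pi / 3), d₃, d₂]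
      ring
    rw [h₃, add_sub_cancel_left, he, mul_div_cancel_left₀ _ hd3, Complex.re_ofReal_mul,
      Complex.exp_ofReal_mul_I_re] at hre
    have hc := pos_of_mul_pos_right hre h0.le
    have := Real.cos_nonpos_of_pi_div_two_le_of_le
      (x := -(θ - 2 * Real.pi / 3 - 2 * Real.pi / 3)) (by linarith) (by linarith)
    rw [Real.cos_neg] at this
    linarith

theorem arg_bounds {u : ℂ} (hu : 0 < u.re) :
    -(Real.pi / 2) < u.arg ∧ u.arg < Real.pi / 2 :=
  abs_lt.1 (Complex.abs_arg_lt_pi_div_two_iff.2 (Or.inl hu))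

/-- Only the bound at the nearer curve needs `him`; the other is automatic, since `arg < π/2 = 2π/3
- π/6`. -/
theorem mem_sector_left {p v : ℂ} (hv : ‖v‖ = 1) {k k' r : ℝ} (hk' : |k'| * r ≤ 1) {z : ℂ}
    (hr : ‖z - p‖ < r) (hre : 0 < ((z - p) / v).re)
    (him : k * Complex.normSq (z - p) < 2 * ((z - p) / v).im) : z ∈ sector p v k k' r := by
  have hv0 : v ≠ 0 := norm_ne_zero_iff.1 (by rw [hv]; exact one_ne_zero)
  set u := (z - p) / v with hu
  have hpi := Real.pi_pos
  have hn : ‖u‖ = ‖z - p‖ := by rw [hu, norm_div, hv, div_one]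
  have hu0 : u ≠ 0 := by
    intro h
    rw [h, Complex.zero_re] at hre
    exact lt_irrefl _ hre
  have hpos : 0 < ‖u‖ := norm_pos_iff.2 hu0
  have harg := arg_bounds hre
  have hb := abs_arcsin_lt (abs_mul_half_lt hk' hpos (hn ▸ hr))
  refine ⟨‖u‖, u.arg, hpos, hn ▸ hr, ?_, by linarith, ?_⟩
  · rw [Real.arcsin_lt_iff_lt_sin' ⟨harg.1, harg.2.le⟩, Complex.sin_arg, lt_div_iff₀ hpos]
    rw [Complex.normSq_eq_norm_sq, ← hn] at him
    linarith
  · rw [Complex.norm_mul_exp_arg_mul_I, hu]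
    field_simp
    ring

theorem mem_sector_right {p v v' : ℂ} (hv : ‖v'‖ = 1) (hvv : v' = v * thirdTurn) {k k' r : ℝ}
    (hk : |k| * r ≤ 1) {z : ℂ} (hr : ‖z - p‖ < r) (hre : 0 < ((z - p) / v').re)
    (him : 2 * ((z - p) / v').im < k' * Complex.normSq (z - p)) : z ∈ sector p v k k' r := by
  have hv0 : v' ≠ 0 := norm_ne_zero_iff.1 (by rw [hv]; exact one_ne_zero)
  set u := (z - p) / v' with hu
  have hpi := Real.pi_pos
  have hn : ‖u‖ = ‖z - p‖ := by rw [hu, norm_div, hv, div_one]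
  have hu0 : u ≠ 0 := by
    intro h
    rw [h, Complex.zero_re] at hre
    exact lt_irrefl _ hre
  have hpos : 0 < ‖u‖ := norm_pos_iff.2 hu0
  have harg := arg_bounds hre
  have hb := abs_arcsin_lt (abs_mul_half_lt hk hpos (hn ▸ hr))
  refine ⟨‖u‖, 2 * Real.pi / 3 + u.arg, hpos, hn ▸ hr, by linarith, ?_, ?_⟩
  · refine add_lt_add_right ?_ _
    rw [Real.lt_arcsin_iff_sin_lt' ⟨harg.1.le, harg.2⟩, Complex.sin_arg, div_lt_iff₀ hpos]
    rw [Complex.normSq_eq_norm_sq, ← hn] at him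
    linarith
  · rw [exp_sub_mul_thirdTurn, add_sub_cancel_left]
    have h1 : v * (‖u‖ * (thirdTurn * Complex.exp (u.arg * Complex.I))) = v' * u := by
      conv_rhs => rw [← Complex.norm_mul_exp_arg_mul_I u]
      rw [hvv]
      ring
    rw [h1, hu]
    field_simp
    ring

namespace CurveArc

/-- The sign of `σ` chooses the side of the curve. The range of `ε` may depend on `t`, which
suffices because `LiesOnSide` concerns one point at a time. -/
theorem eventually_near_normal (e : CurveArc) {r : ℝ} (hr : 0 < r) (σ : ℝ) :
    ∀ᶠ t : ℝ in 𝓝[>] 0, ∀ᶠ ε : ℝ in 𝓝[>] 0,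
      ‖e.point t + (σ * ε : ℝ) * (Complex.I * e.tangent t) - e.base‖ < r ∧
      0 < ((e.point t + (σ * ε : ℝ) * (Complex.I * e.tangent t) - e.base) / e.dir).re := by
  obtain ⟨δ, hδ, hre⟩ := e.exists_re_pos
  have h1 : ∀ᶠ t : ℝ in 𝓝[>] 0, ‖e.point t - e.base‖ < r := by
    have hc : Continuous fun t => ‖e.point t - e.base‖ :=
      (e.continuous_point.sub continuous_const).norm
    refine nhdsWithin_le_nhds (hc.continuousAt.eventually (gt_mem_nhds ?_))
    simpa using hr
  filter_upwards [h1, Ioc_mem_nhdsGT hδ] with t ht ht'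
  have h2 := hre t ht'.1 ht'.2
  have hc : Continuous fun ε : ℝ =>
      e.point t + (σ * ε : ℝ) * (Complex.I * e.tangent t) - e.base := by fun_prop
  have hc' : Continuous fun ε : ℝ =>
      ((e.point t + (σ * ε : ℝ) * (Complex.I * e.tangent t) - e.base) / e.dir).re :=
    Complex.continuous_re.comp (hc.div_const _)
  refine Eventually.and (nhdsWithin_le_nhds (hc.norm.continuousAt.eventually (gt_mem_nhds ?_)))
    (nhdsWithin_le_nhds (hc'.continuousAt.eventually (lt_mem_nhds ?_)))
  · simpa using ht
  · simpa using h2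

end CurveArc

theorem eventually_offset_pos (k : ℝ) : ∀ᶠ ε : ℝ in 𝓝[>] 0, |k| * ε < 1 ∧ 0 < ε := by
  have hc : Continuous fun ε : ℝ => |k| * ε := by fun_prop
  refine Eventually.and (nhdsWithin_le_nhds (hc.continuousAt.eventually (gt_mem_nhds ?_)))
    self_mem_nhdsWithin
  simp

/-- Two curves that leave a point consecutively have a common bubble between them. -/
theorem exists_bubble_between {S : Finset CurveArc} {p : ℂ} {e₁ e₂ e₃ : CurveArc}
    (h₁ : e₁.base = p) (h₂ : e₂.base = p) (h₃ : e₃.base = p)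
    (d₂ : e₂.dir = e₁.dir * thirdTurn) (d₃ : e₃.dir = e₂.dir * thirdTurn)
    (hloc : ∀ᶠ z in 𝓝 p, z ∈ film S → z = p ∨ e₁.AheadOn z ∨ e₂.AheadOn z ∨ e₃.AheadOn z) :
    ∃ W, IsBubble S W ∧
      (∀ᶠ t : ℝ in 𝓝[>] 0, LiesOnSide W (e₁.point t) (Complex.I * e₁.tangent t)) ∧
      (∀ᶠ t : ℝ in 𝓝[>] 0, LiesOnSide W (e₂.point t) (-(Complex.I * e₂.tangent t))) := by
  obtain ⟨r₀, hr₀, hball⟩ := Metric.eventually_nhds_iff.1 hloc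
  -- The radius is small enough for the local description of the film and for the `π/6` bound on
  -- both arcs.
  obtain ⟨r, hr, hrr, hk, hk'⟩ : ∃ r > 0, r ≤ r₀ ∧ |e₁.curvature| * r ≤ 1 ∧
      |e₂.curvature| * r ≤ 1 := by
    have ha : (0 : ℝ) < 1 / (|e₁.curvature| + |e₂.curvature| + 1) := by positivity
    have hden : 0 < |e₁.curvature| + |e₂.curvature| + 1 := by positivity
    have hm : min r₀ (1 / (|e₁.curvature| + |e₂.curvature| + 1)) *
        (|e₁.curvature| + |e₂.curvature| + 1) ≤ 1 := by
      refine (mul_le_mul_of_nonneg_right (min_le_right _ _) hden.le).trans ?_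
      rw [one_div, inv_mul_cancel₀ hden.ne']
    have hpos := lt_min hr₀ ha
    refine ⟨_, hpos, min_le_left _ _, ?_, ?_⟩
    · nlinarith [abs_nonneg e₁.curvature, abs_nonneg e₂.curvature]
    · nlinarith [abs_nonneg e₁.curvature, abs_nonneg e₂.curvature]
  set Q := sector p e₁.dir e₁.curvature e₂.curvature r with hQ
  have hsub : Q ⊆ (film S)ᶜ := by
    intro z hz hzf
    have hn := not_aheadOn_of_mem_sector h₁ h₂ h₃ d₂ d₃ hk hk' hz
    have hdist : dist z p < r₀ := by
      obtain ⟨ρ, θ, h0, hr', -, -, rfl⟩ := hz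
      rw [dist_eq_norm, add_sub_cancel_left, norm_mul, norm_mul, e₁.norm_dir,
        Complex.norm_exp_ofReal_mul_I, Complex.norm_real, Real.norm_eq_abs, abs_of_pos h0]
      linarith
    rcases hball hdist hzf with h | h | h | h
    exacts [hn.1 h, hn.2.1 h, hn.2.2.1 h, hn.2.2.2 h]
  have hpi := Real.pi_pos
  have hz₀ : p + e₁.dir * ((r / 2 : ℝ) * Complex.exp ((Real.pi / 3 : ℝ) * Complex.I)) ∈ Q := by
    have ha := abs_arcsin_lt (abs_mul_half_lt hk (half_pos hr) (half_lt_self hr))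
    have hb := abs_arcsin_lt (abs_mul_half_lt hk' (half_pos hr) (half_lt_self hr))
    exact ⟨r / 2, Real.pi / 3, half_pos hr, half_lt_self hr, by linarith, by linarith, rfl⟩
  refine ⟨_, ⟨_, hsub hz₀, rfl⟩, ?_, ?_⟩
  · filter_upwards [e₁.eventually_near_normal hr 1] with t ht
    filter_upwards [ht, eventually_offset_pos e₁.curvature] with ε hε hε'
    rw [one_mul, h₁] at hε
    refine (isPreconnected_sector p e₁.dir hk hk').subset_connectedComponentIn hz₀ hsub
      (mem_sector_left e₁.norm_dir hk' hε.1 hε.2 ?_)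
    have := e₁.normal_offset t ε
    rw [h₁] at this
    have h3 : e₁.curvature * ε < 1 := (mul_le_mul_of_nonneg_right (le_abs_self _)
      hε'.2.le).trans_lt hε'.1
    nlinarith [hε'.2]
  · filter_upwards [e₂.eventually_near_normal hr (-1)] with t ht
    filter_upwards [ht, eventually_offset_pos e₂.curvature] with ε hε hε'
    have heq : e₂.point t + (ε : ℂ) * -(Complex.I * e₂.tangent t) =
        e₂.point t + (-1 * ε : ℝ) * (Complex.I * e₂.tangent t) := by
      push_cast
      ring
    rw [heq]
    rw [h₂] at hε
    refine (isPreconnected_sector p e₁.dir hk hk').subset_connectedComponentIn hz₀ hsub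
      (mem_sector_right e₂.norm_dir d₂ hk hε.1 hε.2 ?_)
    have := e₂.normal_offset t (-1 * ε)
    rw [h₂] at this
    have h3 : -e₂.curvature * ε < 1 := (mul_le_mul_of_nonneg_right (neg_le_abs _)
      hε'.2.le).trans_lt hε'.1
    nlinarith [hε'.2]

/-- If there are pressures that satisfy the Young--Laplace equation, then the curvatures balance at
the endpoints. -/
theorem curvatureBalance {S : Finset CurveArc} (hS : PlateauLaws S) {γ : ℝ} (hγ : 0 < γ)
    {P : Set ℂ → ℝ} (hP : YoungLaplace S γ P) : CurvatureBalance S := by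
  intro p
  by_cases h : ∃ c ∈ S, c.IsEndpoint p
  · obtain ⟨c, hc, hp⟩ := h
    obtain ⟨e₁, e₂, e₃, ⟨b₁, b₂, b₃⟩, ⟨d₂, d₃⟩, ⟨s₁, s₂, s₃⟩, hcar, hsum, -⟩ :=
      hS.exists_junction hc hp
    rw [hsum]
    have d₁ : e₁.dir = e₃.dir * thirdTurn := by
      rw [d₃, d₂]
      linear_combination -e₁.dir * thirdTurn_cube
    have hloc : ∀ᶠ z in 𝓝 p, z ∈ film S →
        z = p ∨ e₁.AheadOn z ∨ e₂.AheadOn z ∨ e₃.AheadOn z := by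
      have h1 := b₁ ▸ e₁.eventually_aheadOn
      have h2 := b₂ ▸ e₂.eventually_aheadOn
      have h3 := b₃ ▸ e₃.eventually_aheadOn
      have h4 : ∀ᶠ z in 𝓝 p, ∀ d ∈ S, p ∉ d.carrier → z ∉ d.carrier := by
        refine (Finset.eventually_all S).2 fun d _ => ?_
        by_cases hpd : p ∈ d.carrier
        · exact Eventually.of_forall fun z h => absurd hpd h
        · filter_upwards [d.isCompact_carrier.isClosed.isOpen_compl.mem_nhds hpd] with z hz _
          exact hz
      filter_upwards [h1, h2, h3, h4] with z hz1 hz2 hz3 hz4 hzf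
      obtain ⟨d, hd, hzd⟩ := mem_iUnion₂.1 hzf
      have hpd : p ∈ d.carrier := by
        by_contra hpd
        exact hz4 d hd hpd hzd
      rcases hcar d hd hpd with h | h | h
      · rcases hz1 (h ▸ hzd) with h | h
        exacts [Or.inl h, Or.inr (Or.inl h)]
      · rcases hz2 (h ▸ hzd) with h | h
        exacts [Or.inl h, Or.inr (Or.inr (Or.inl h))]
      · rcases hz3 (h ▸ hzd) with h | h
        exacts [Or.inl h, Or.inr (Or.inr (Or.inr h))]
    obtain ⟨W₁, hW₁, l₁, r₂⟩ := exists_bubble_between b₁ b₂ b₃ d₂ d₃ hloc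
    obtain ⟨W₂, hW₂, l₂, r₃⟩ := exists_bubble_between b₂ b₃ b₁ d₃ d₁
      (hloc.mono fun z hz hzf => by tauto)
    obtain ⟨W₃, hW₃, l₃, r₁⟩ := exists_bubble_between b₃ b₁ b₂ d₁ d₂
      (hloc.mono fun z hz hzf => by tauto)
    obtain ⟨t₁, ⟨hl₁, hr₁⟩, ht₁⟩ := ((l₁.and r₁).and (Ioo_mem_nhdsGT e₁.length_pos)).exists
    obtain ⟨t₂, ⟨hl₂, hr₂⟩, ht₂⟩ := ((l₂.and r₂).and (Ioo_mem_nhdsGT e₂.length_pos)).exists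
    obtain ⟨t₃, ⟨hl₃, hr₃⟩, ht₃⟩ := ((l₃.and r₃).and (Ioo_mem_nhdsGT e₃.length_pos)).exists
    -- Each of the three bubbles occurs once on the left and once on the right, so the pressures
    -- cancel in the sum and `γ` times the sum of the curvatures is zero.
    have q₁ := hP.outgoing s₁ ht₁ hW₁ hW₃ hl₁ hr₁
    have q₂ := hP.outgoing s₂ ht₂ hW₂ hW₁ hl₂ hr₂
    have q₃ := hP.outgoing s₃ ht₃ hW₃ hW₂ hl₃ hr₃
    apply mul_left_cancel₀ hγ.ne'
    linarith
  · push Not at h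
    refine Finset.sum_eq_zero fun c hc => ?_
    rw [if_neg fun h' => h c hc (Or.inl h'.symm), if_neg fun h' => h c hc (Or.inr h'.symm),
      sub_zero]

/-! ### Transport of clusters by conformal maps. -/

/-- A curve with a regular parametrization of constant curvature is an arc or a segment. -/
theorem exists_arc_of_parametrization {L : ℝ} (hL : 0 < L) {h U : ℝ → ℂ} {σ : ℝ → ℝ} {κ : ℝ}
    (hσc : ContinuousOn σ (Icc 0 L)) (hσ : ∀ t ∈ Icc 0 L, 0 < σ t)
    (hh : ∀ t ∈ Icc 0 L, HasDerivAt h (σ t * U t) t)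
    (hU : ∀ t ∈ Icc 0 L, HasDerivAt U (Complex.I * κ * σ t * U t) t) (hU0 : ‖U 0‖ = 1)
    (hinj : InjOn h (Icc 0 L)) :
    ∃ c : CurveArc, c.carrier = h '' Icc 0 L ∧ c.point 0 = h 0 ∧ c.point c.length = h L ∧
      c.tangent 0 = U 0 ∧ c.tangent c.length = U L ∧ c.curvature = κ := by
  -- Extending the speed by constants makes the arc length `s` differentiable and strictly
  -- increasing on the whole line.
  set σ' : ℝ → ℝ := IccExtend hL.le ((Icc 0 L).domRestrict σ) with hσ'
  have hσ'c : Continuous σ' := continuous_IccExtend_iff.2 hσc.domRestrict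
  have hσ'eq : ∀ t ∈ Icc 0 L, σ' t = σ t := fun t ht => IccExtend_of_mem _ _ ht
  have hσ'pos : ∀ t, 0 < σ' t := fun t => hσ _ (projIcc 0 L hL.le t).2
  set s : ℝ → ℝ := fun t => ∫ x in (0 : ℝ)..t, σ' x with hs
  have hsd : ∀ t, HasDerivAt s (σ' t) t := fun t =>
    intervalIntegral.integral_hasDerivAt_right (hσ'c.intervalIntegrable _ _)
      (hσ'c.stronglyMeasurableAtFilter _ _) hσ'c.continuousAt
  have hsc : Continuous s := continuous_iff_continuousAt.2 fun t => (hsd t).continuousAt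
  have hs0 : s 0 = 0 := intervalIntegral.integral_same
  have hsm : StrictMono s := strictMono_of_deriv_pos fun t => by
    rw [(hsd t).deriv]
    exact hσ'pos t
  have hsL : 0 < s L := hs0 ▸ hsm hL
  have h0 : (0 : ℝ) ∈ Icc 0 L := ⟨le_rfl, hL.le⟩
  have himg : s '' Icc 0 L = Icc 0 (s L) := by
    have hs0L := intermediate_value_Icc hL.le hsc.continuousOn
    rw [hs0] at hs0L
    exact Subset.antisymm
      (image_subset_iff.2 fun t ht => mem_Icc.2 ⟨hs0 ▸ hsm.monotone ht.1, hsm.monotone ht.2⟩)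
      hs0L
  have hconst : ∀ f : ℝ → ℂ, (∀ t ∈ Icc 0 L, HasDerivAt f 0 t) → ∀ t ∈ Icc 0 L, f t = f 0 := by
    intro f hf
    refine constant_of_has_deriv_right_zero (fun t ht => (hf t ht).continuousAt.continuousWithinAt)
      fun t ht => (hf t (Ico_subset_Icc_self ht)).hasDerivWithinAt
  -- A curve is determined by its initial data and curvature, whatever its length. This is needed
  -- for an auxiliary curve first, since the bound on the turning must be known before the final
  -- curve can be formed.
  have key : ∀ c : CurveArc, c.base = h 0 → c.dir = U 0 → c.curvature = κ →
      ∀ t ∈ Icc 0 L, c.tangent (s t) = U t ∧ c.point (s t) = h t := by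
    intro c hb hd hk
    have htan : ∀ t ∈ Icc 0 L, c.tangent (s t) = U t := by
      intro t ht
      have hE : ∀ t, HasDerivAt (fun t => Complex.exp (-(((κ * s t : ℝ) : ℂ) * Complex.I)))
          (Complex.exp (-(((κ * s t : ℝ) : ℂ) * Complex.I)) * -(((κ * σ' t : ℝ) : ℂ) * Complex.I))
          t := fun t => ((((hsd t).const_mul κ).ofReal_comp.mul_const _).fun_neg).cexp
      have h1 := hconst (fun t => U t * Complex.exp (-(((κ * s t : ℝ) : ℂ) * Complex.I))) (by
        intro t ht
        refine ((hU t ht).fun_mul (hE t)).congr_deriv ?_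
        rw [hσ'eq t ht]
        push_cast
        ring) t ht
      simp only [hs0, mul_zero, Complex.ofReal_zero, zero_mul, neg_zero, Complex.exp_zero,
        mul_one] at h1
      rw [CurveArc.tangent, hd, hk, ← h1, mul_assoc, ← Complex.exp_add, neg_add_cancel,
        Complex.exp_zero, mul_one]
    intro t ht
    refine ⟨htan t ht, ?_⟩
    have h1 := hconst (fun t => c.point (s t) - h t) (by
      intro t ht
      refine (((c.hasDerivAt_point (s t)).scomp t (hsd t)).fun_sub (hh t ht)).congr_deriv ?_
      rw [htan t ht, hσ'eq t ht, Complex.real_smul, sub_self]) t ht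
    simp only [hs0, c.point_zero, hb, sub_self] at h1
    exact sub_eq_zero.1 h1
  have hturn : |κ| * s L < 2 * Real.pi := by
    by_contra hcon
    push Not at hcon
    have hpi := Real.two_pi_pos
    have hκ : 0 < |κ| := by
      rcases (abs_nonneg κ).eq_or_lt with h' | h'
      · rw [← h', zero_mul] at hcon
        linarith
      · exact h'
    have hκ0 : κ ≠ 0 := abs_pos.1 hκ
    have hmem : 2 * Real.pi / |κ| ∈ Icc 0 (s L) :=
      ⟨by positivity, (div_le_iff₀ hκ).2 (by linarith)⟩
    rw [← himg] at hmem
    obtain ⟨t, ht, hst⟩ := hmem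
    -- Any admissible length would do, as `point` is defined for all arc lengths. After arc length
    -- `2π/|κ|` it returns to its start, contradicting the injectivity of `h`.
    set c : CurveArc := ⟨h 0, U 0, κ, Real.pi / |κ|, hU0, by positivity, by
      rw [mul_div_cancel₀ _ hκ.ne']
      linarith [Real.pi_pos]⟩ with hc
    have h1 := (key c rfl rfl rfl t ht).2
    have h2 : c.point (s t) = c.point 0 := by
      have h3 : Complex.exp ((κ * s t : ℝ) * Complex.I) = 1 := by
        rw [hst]
        rcases abs_choice κ with h' | h'
        · rw [h', mul_div_cancel₀ _ hκ0]
          push_cast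
          exact Complex.exp_two_pi_mul_I
        · rw [h', div_neg, mul_neg, mul_div_cancel₀ _ hκ0]
          push_cast
          rw [neg_mul, Complex.exp_neg, Complex.exp_two_pi_mul_I, inv_one]
      rw [CurveArc.point_of_curvature_ne_zero c hκ0, CurveArc.point_of_curvature_ne_zero c hκ0,
        show c.curvature = κ from rfl, h3, mul_zero, Complex.ofReal_zero, zero_mul,
        Complex.exp_zero]
    have h4 : t = 0 := hinj ht h0 (by rw [← h1, h2, c.point_zero])
    rw [h4, hs0] at hst
    have : 0 < 2 * Real.pi / |κ| := by positivity
    linarith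
  set c : CurveArc := ⟨h 0, U 0, κ, s L, hU0, hsL, hturn⟩ with hc
  have hk := key c rfl rfl rfl
  have hLm : L ∈ Icc 0 L := ⟨hL.le, le_rfl⟩
  refine ⟨c, ?_, c.point_zero, (hk L hLm).2, c.tangent_zero, (hk L hLm).1, rfl⟩
  rw [CurveArc.carrier, show c.length = s L from rfl, ← himg, image_image]
  exact image_congr fun t ht => (hk t ht).2

/-- A map that is angle-preserving and transforms curves into curves, with a curvature that depends
linearly on the tangent and the curvature, transforms clusters into clusters. -/
theorem isSoapBubbleCluster_image {S : Finset CurveArc} (hS : PlateauLaws S)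
    (hK : CurvatureBalance S) {f : ℂ → ℂ} (hf : InjOn f (film S)) {D : ℂ → ℂ → ℂ}
    (hDneg : ∀ p v, D p (-v) = -D p v)
    (hD : ∀ p ∈ film S, ∀ v w, InnerProductGeometry.angle (D p v) (D p w) =
      InnerProductGeometry.angle v w)
    {A : ℂ → ℝ} {ℓ : ℂ → ℂ →+ ℝ}
    (h : ∀ c ∈ S, ∃ c' : CurveArc, c'.carrier = f '' c.carrier ∧ c'.point 0 = f (c.point 0) ∧
      c'.point c'.length = f (c.point c.length) ∧ c'.tangent 0 = D (c.point 0) (c.tangent 0) ∧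
      c'.tangent c'.length = D (c.point c.length) (c.tangent c.length) ∧
      c'.curvature = A (c.point 0) * c.curvature + ℓ (c.point 0) (c.tangent 0) ∧
      c'.curvature = A (c.point c.length) * c.curvature +
        ℓ (c.point c.length) (c.tangent c.length)) :
    IsSoapBubbleCluster ((fun X => f '' X) '' (CurveArc.carrier '' (S : Set CurveArc))) := by
  classical
  choose! φ hcar h0 h1 ht0 ht1 hk0 hk1 using h
  have hend : ∀ c ∈ S, ∀ p, (φ c).IsEndpoint p → ∃ q, c.IsEndpoint q ∧ f q = p := by
    intro c hc p hp
    rcases hp with rfl | rfl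
    · exact ⟨c.point 0, Or.inl rfl, (h0 c hc).symm⟩
    · exact ⟨c.point c.length, Or.inr rfl, (h1 c hc).symm⟩
  have hend' : ∀ c ∈ S, ∀ q, c.IsEndpoint q → (φ c).IsEndpoint (f q) := by
    intro c hc q hq
    rcases hq with rfl | rfl
    · exact Or.inl (h0 c hc).symm
    · exact Or.inr (h1 c hc).symm
  have hmem : ∀ c ∈ S, ∀ q ∈ film S, f q ∈ (φ c).carrier ↔ q ∈ c.carrier := by
    intro c hc q hq
    rw [hcar c hc, hf.mem_image_iff (carrier_subset_film hc) hq]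
  -- The midpoint of a curve lies on no other curve, so distinct curves have distinct images.
  have hinj : InjOn φ (S : Set CurveArc) := by
    intro c hc d hd hcd
    by_contra hne
    have hm : c.length / 2 ∈ Ioo 0 c.length := ⟨half_pos c.length_pos, half_lt_self c.length_pos⟩
    have hcc := c.point_mem_carrier (Ioo_subset_Icc_self hm)
    have hdd : c.point (c.length / 2) ∈ d.carrier := by
      rw [← hmem d hd _ (carrier_subset_film hc hcc), ← hcd,
        hmem c hc _ (carrier_subset_film hc hcc)]
      exact hcc
    exact c.not_isEndpoint hm (hS.noncrossing c hc d hd hne _ ⟨hcc, hdd⟩).1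
  have hleave : ∀ c ∈ S, ∀ q ∈ film S, ∀ v, (φ c).LeavesFrom (f q) v →
      ∃ w, c.LeavesFrom q w ∧ v = D q w := by
    intro c hc q hq v hv
    rcases hv with ⟨hp, rfl⟩ | ⟨hp, rfl⟩
    · have := hf hq (carrier_subset_film hc (c.point_mem_carrier c.zero_mem)) (hp.trans (h0 c hc))
      exact ⟨c.tangent 0, Or.inl ⟨this, rfl⟩, by rw [ht0 c hc, this]⟩
    · have := hf hq (carrier_subset_film hc (c.point_mem_carrier c.length_mem))
        (hp.trans (h1 c hc))
      exact ⟨-c.tangent c.length, Or.inr ⟨this, rfl⟩, by rw [ht1 c hc, hDneg, this]⟩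
  set S' := S.image φ with hS'
  have hP' : PlateauLaws S' := by
    constructor
    · intro c' hc' d' hd' hne p hp
      obtain ⟨c, hc, rfl⟩ := Finset.mem_image.1 hc'
      obtain ⟨d, hd, rfl⟩ := Finset.mem_image.1 hd'
      have hp1 := hp.1
      rw [hcar c hc] at hp1
      obtain ⟨q, hq, rfl⟩ := hp1
      have hqd := (hmem d hd q (carrier_subset_film hc hq)).1 hp.2
      have := hS.noncrossing c hc d hd (fun hcd => hne (hcd ▸ rfl)) q ⟨hq, hqd⟩
      exact ⟨hend' c hc q this.1, hend' d hd q this.2⟩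
    · intro c' hc' p hp
      obtain ⟨c, hc, rfl⟩ := Finset.mem_image.1 hc'
      obtain ⟨q, hq, rfl⟩ := hend c hc p hp
      have hqf := carrier_subset_film hc hq.mem_carrier
      rw [← hS.three_meet c hc q hq,
        ← (hinj.mono (s₁ := {d | d ∈ S ∧ q ∈ d.carrier}) fun d hd => hd.1).ncard_image]
      congr 1
      ext d'
      constructor
      · rintro ⟨hd', hpd⟩
        obtain ⟨d, hd, rfl⟩ := Finset.mem_image.1 hd'
        exact ⟨d, ⟨hd, (hmem d hd q hqf).1 hpd⟩, rfl⟩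
      · rintro ⟨d, ⟨hd, hqd⟩, rfl⟩
        exact ⟨Finset.mem_image_of_mem _ hd, (hmem d hd q hqf).2 hqd⟩
    · intro c' hc' d' hd' hne p v w hv hw
      obtain ⟨c, hc, rfl⟩ := Finset.mem_image.1 hc'
      obtain ⟨d, hd, rfl⟩ := Finset.mem_image.1 hd'
      have hp : (φ c).IsEndpoint p := hv.imp And.left And.left
      obtain ⟨q, hq, rfl⟩ := hend c hc p hp
      have hqf := carrier_subset_film hc hq.mem_carrier
      obtain ⟨v₀, hv₀, rfl⟩ := hleave c hc q hqf v hv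
      obtain ⟨w₀, hw₀, rfl⟩ := hleave d hd q hqf w hw
      rw [hD q hqf]
      exact hS.angle_eq c hc d hd (fun hcd => hne (hcd ▸ rfl)) q _ _ hv₀ hw₀
  have hK' : CurvatureBalance S' := by
    intro p
    rw [hS', Finset.sum_image hinj]
    by_cases hp : ∃ c ∈ S, (φ c).IsEndpoint p
    · obtain ⟨c, hc, hcp⟩ := hp
      obtain ⟨q, hq, rfl⟩ := hend c hc p hcp
      have hqf := carrier_subset_film hc hq.mem_carrier
      -- Additivity of `ℓ q` includes oddness, so the formula also covers curves that end at `q`.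
      -- Summation then yields `A q` times the curvature balance plus `ℓ q` of the tangent balance.
      have hterm : ∀ d ∈ S, ((if (φ d).point 0 = f q then (φ d).curvature else 0) -
          (if (φ d).point (φ d).length = f q then (φ d).curvature else 0)) =
          A q * ((if d.point 0 = q then d.curvature else 0) -
            (if d.point d.length = q then d.curvature else 0)) +
          ℓ q ((if d.point 0 = q then d.tangent 0 else 0) -
            (if d.point d.length = q then d.tangent d.length else 0)) := by
        intro d hd
        have e0 : (φ d).point 0 = f q ↔ d.point 0 = q := by
          rw [h0 d hd]
          exact hf.eq_iff (carrier_subset_film hd (d.point_mem_carrier d.zero_mem)) hqf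
        have e1 : (φ d).point (φ d).length = f q ↔ d.point d.length = q := by
          rw [h1 d hd]
          exact hf.eq_iff (carrier_subset_film hd (d.point_mem_carrier d.length_mem)) hqf
        have s0 : (if (φ d).point 0 = f q then (φ d).curvature else 0) =
            A q * (if d.point 0 = q then d.curvature else 0) +
              ℓ q (if d.point 0 = q then d.tangent 0 else 0) := by
          by_cases hq0 : d.point 0 = q
          · rw [if_pos (e0.2 hq0), if_pos hq0, if_pos hq0, hk0 d hd, hq0]
          · rw [if_neg (mt e0.1 hq0), if_neg hq0, if_neg hq0, map_zero, mul_zero, add_zero]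
        have s1 : (if (φ d).point (φ d).length = f q then (φ d).curvature else 0) =
            A q * (if d.point d.length = q then d.curvature else 0) +
              ℓ q (if d.point d.length = q then d.tangent d.length else 0) := by
          by_cases hq0 : d.point d.length = q
          · rw [if_pos (e1.2 hq0), if_pos hq0, if_pos hq0, hk1 d hd, hq0]
          · rw [if_neg (mt e1.1 hq0), if_neg hq0, if_neg hq0, map_zero, mul_zero, add_zero]
        rw [s0, s1, map_sub]
        ring
      rw [Finset.sum_congr rfl hterm, Finset.sum_add_distrib, ← Finset.mul_sum, hK q,
        ← map_sum, hS.tangentBalance q, map_zero, mul_zero, add_zero]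
    · push Not at hp
      refine Finset.sum_eq_zero fun c hc => ?_
      rw [if_neg fun h' => hp c hc (Or.inl h'.symm), if_neg fun h' => hp c hc (Or.inr h'.symm),
        sub_zero]
  obtain ⟨P, hP⟩ := exists_youngLaplace hP' hK'
  refine ⟨S', ?_, hP', 1, one_pos, P, hP⟩
  rw [hS', Finset.coe_image, image_image, image_image]
  exact image_congr fun c hc => (hcar c hc).symm

/-! ### Affine maps, conjugation and inversion. -/

theorem isSoapBubbleCluster_affine {B : Set (Set ℂ)} (hB : IsSoapBubbleCluster B) {a : ℂ}
    (ha : a ≠ 0) (b : ℂ) : IsSoapBubbleCluster ((fun X => (fun z => a * z + b) '' X) '' B) := by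
  obtain ⟨S, rfl, hS, γ, hγ, P, hP⟩ := hB
  have hn : (‖a‖ : ℂ) ≠ 0 := by exact_mod_cast (norm_pos_iff.2 ha).ne'
  have hinj : Function.Injective fun z => a * z + b := fun x y hxy =>
    mul_left_cancel₀ ha (add_right_cancel hxy)
  refine isSoapBubbleCluster_image hS (curvatureBalance hS hγ hP) hinj.injOn
    (D := fun _ v => a / ‖a‖ * v) (A := fun _ => 1 / ‖a‖) (ℓ := 0) ?_ ?_ fun c hc => ?_
  · intro p v
    ring
  · intro p _ v w
    exact Complex.angle_mul_left (div_ne_zero ha hn) v w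
  · refine (exists_arc_of_parametrization c.length_pos
      (h := fun t => a * c.point t + b) (U := fun t => a / ‖a‖ * c.tangent t)
      (σ := fun _ => ‖a‖) (κ := 1 / ‖a‖ * c.curvature) continuousOn_const
      (fun _ _ => norm_pos_iff.2 ha) (fun t _ => ?_) (fun t _ => ?_) ?_
      (hinj.comp_injOn c.point_injOn)).imp
      fun c' ⟨h1, h2, h3, h4, h5, h6⟩ => ?_
    · refine (((c.hasDerivAt_point t).const_mul a).add_const b).congr_deriv ?_
      field_simp
    · refine ((c.hasDerivAt_tangent t).const_mul (a / ‖a‖ : ℂ)).congr_deriv ?_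
      push_cast
      field_simp
    · rw [norm_mul, norm_div, c.norm_tangent, Complex.norm_real, norm_norm,
        div_self (norm_pos_iff.2 ha).ne', one_mul]
    · refine ⟨?_, h2, h3, h4, h5, ?_, ?_⟩
      · rw [h1, CurveArc.carrier, image_image]
      · simpa using h6
      · simpa using h6

theorem isSoapBubbleCluster_conj {B : Set (Set ℂ)} (hB : IsSoapBubbleCluster B) :
    IsSoapBubbleCluster ((fun X => starRingEnd ℂ '' X) '' B) := by
  obtain ⟨S, rfl, hS, γ, hγ, P, hP⟩ := hB
  have hinj : Function.Injective (starRingEnd ℂ) := (starRingEnd ℂ).injective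
  refine isSoapBubbleCluster_image hS (curvatureBalance hS hγ hP) hinj.injOn
    (D := fun _ v => starRingEnd ℂ v) (A := fun _ => -1) (ℓ := 0) ?_ ?_ fun c hc => ?_
  · intro p v
    simp
  · intro p _ v w
    exact Complex.conjLIE.toLinearIsometry.angle_map v w
  · have hder : ∀ {g : ℝ → ℂ} {g' : ℂ} {t : ℝ}, HasDerivAt g g' t →
        HasDerivAt (fun t => starRingEnd ℂ (g t)) (starRingEnd ℂ g') t := by
      intro g g' t hg
      exact Complex.conjCLE.toContinuousLinearMap.hasFDerivAt.comp_hasDerivAt t hg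
    refine (exists_arc_of_parametrization c.length_pos
      (h := fun t => starRingEnd ℂ (c.point t)) (U := fun t => starRingEnd ℂ (c.tangent t))
      (σ := fun _ => 1) (κ := -c.curvature) continuousOn_const
      (fun _ _ => one_pos) (fun t _ => ?_) (fun t _ => ?_) ?_
      (hinj.comp_injOn c.point_injOn)).imp
      fun c' ⟨h1, h2, h3, h4, h5, h6⟩ => ?_
    · refine (hder (c.hasDerivAt_point t)).congr_deriv ?_
      simp
    · refine (hder (c.hasDerivAt_tangent t)).congr_deriv ?_
      simp
    · rw [RCLike.norm_conj, c.norm_tangent]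
    · refine ⟨?_, h2, h3, h4, h5, ?_, ?_⟩
      · rw [h1, CurveArc.carrier, image_image]
      · simpa using h6
      · simpa using h6

/-- The curvature of the image of a curve under inversion, as a function of the tangent. -/
noncomputable def inversionCurvature (p : ℂ) : ℂ →+ ℝ where
  toFun v := -2 * (starRingEnd ℂ p * v).im
  map_zero' := by simp
  map_add' v w := by
    rw [mul_add, Complex.add_im]
    ring

/-- This is the curvature of the inverted curve, which must not depend on the point at which it is
computed; the difference of the two sides reduces to `im_chord`. -/
theorem CurveArc.inversionCurvature_eq (c : CurveArc) (s t : ℝ) :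
    Complex.normSq (c.point t) * c.curvature + inversionCurvature (c.point t) (c.tangent t) =
    Complex.normSq (c.point s) * c.curvature + inversionCurvature (c.point s) (c.tangent s) := by
  have h1 := c.im_chord s t
  have h2 : c.tangent t = c.tangent s + Complex.I * c.curvature * (c.point t - c.point s) := by
    linear_combination c.tangent_sub_tangent s t
  have h3 : ((c.point t - c.point s) / c.tangent s).im =
      ((c.point t - c.point s) * starRingEnd ℂ (c.tangent s)).im := by
    rw [div_eq_mul_inv, Complex.inv_def, Complex.normSq_eq_norm_sq, c.norm_tangent]
    simp
  rw [h3, Complex.normSq_apply] at h1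
  rw [h2]
  simp only [inversionCurvature, AddMonoidHom.coe_mk, ZeroHom.coe_mk, Complex.normSq_apply]
  simp at h1 ⊢
  linear_combination h1

/-- The derivative `-1/p²` of the inversion has modulus `1/|p|²` and direction `-(conj p)/p`; these
are the speed and the rotation of the tangent. -/
theorem isSoapBubbleCluster_inv {B : Set (Set ℂ)} (hB : IsSoapBubbleCluster B)
    (h0 : ∀ X ∈ B, (0 : ℂ) ∉ X) :
    IsSoapBubbleCluster ((fun X => (fun z : ℂ => z⁻¹) '' X) '' B) := by
  obtain ⟨S, rfl, hS, γ, hγ, P, hP⟩ := hB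
  have hne : ∀ z ∈ film S, z ≠ 0 := by
    rintro z hz rfl
    obtain ⟨c, hc, hz⟩ := mem_iUnion₂.1 hz
    exact h0 _ (mem_image_of_mem _ hc) hz
  have hinj : Function.Injective fun z : ℂ => z⁻¹ := inv_injective
  refine isSoapBubbleCluster_image hS (curvatureBalance hS hγ hP) hinj.injOn
    (D := fun p v => -(starRingEnd ℂ p / p) * v) (A := fun p => Complex.normSq p)
    (ℓ := inversionCurvature) ?_ ?_ fun c hc => ?_
  · intro p v
    ring
  · intro p hp v w
    have := hne p hp
    exact Complex.angle_mul_left (neg_ne_zero.2 (div_ne_zero (by simpa using this) this)) v w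
  · have hz : ∀ t ∈ Icc 0 c.length, c.point t ≠ 0 := fun t ht =>
      hne _ (carrier_subset_film hc (c.point_mem_carrier ht))
    have hder : ∀ {g : ℝ → ℂ} {g' : ℂ} {t : ℝ}, HasDerivAt g g' t →
        HasDerivAt (fun t => starRingEnd ℂ (g t)) (starRingEnd ℂ g') t := by
      intro g g' t hg
      exact Complex.conjCLE.toContinuousLinearMap.hasFDerivAt.comp_hasDerivAt t hg
    refine (exists_arc_of_parametrization c.length_pos
      (h := fun t => (c.point t)⁻¹)
      (U := fun t => -(starRingEnd ℂ (c.point t) / c.point t) * c.tangent t)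
      (σ := fun t => 1 / Complex.normSq (c.point t))
      (κ := Complex.normSq (c.point 0) * c.curvature +
        inversionCurvature (c.point 0) (c.tangent 0)) ?_
      (fun t ht => one_div_pos.2 (Complex.normSq_pos.2 (hz t ht))) (fun t ht => ?_)
      (fun t ht => ?_) ?_ (hinj.comp_injOn c.point_injOn)).imp
      fun c' ⟨h1, h2, h3, h4, h5, h6⟩ => ?_
    · exact continuousOn_const.div (Complex.continuous_normSq.comp c.continuous_point).continuousOn
        fun t ht => (Complex.normSq_pos.2 (hz t ht)).ne'
    · have hzt := hz t ht
      have hzt' : starRingEnd ℂ (c.point t) ≠ 0 := by simpa using hzt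
      refine ((c.hasDerivAt_point t).fun_inv hzt).congr_deriv ?_
      rw [Complex.ofReal_div, Complex.ofReal_one, ← Complex.mul_conj]
      field_simp
    · have hzt := hz t ht
      have hzt' : starRingEnd ℂ (c.point t) ≠ 0 := by simpa using hzt
      rw [← c.inversionCurvature_eq 0 t]
      refine ((((hder (c.hasDerivAt_point t)).fun_div (c.hasDerivAt_point t) hzt).fun_neg).fun_mul
        (c.hasDerivAt_tangent t)).congr_deriv ?_
      have hl : ((inversionCurvature (c.point t) (c.tangent t) : ℝ) : ℂ) =
          Complex.I * (starRingEnd ℂ (c.point t) * c.tangent t -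
            c.point t * starRingEnd ℂ (c.tangent t)) := by
        have h7 : starRingEnd ℂ (c.point t) * c.tangent t - c.point t * starRingEnd ℂ (c.tangent t)
            = (2 * (starRingEnd ℂ (c.point t) * c.tangent t).im : ℝ) * Complex.I := by
          rw [← Complex.sub_conj, map_mul, Complex.conj_conj]
        rw [h7]
        simp only [inversionCurvature, AddMonoidHom.coe_mk, ZeroHom.coe_mk]
        push_cast
        linear_combination (-2 * ((starRingEnd ℂ (c.point t) * c.tangent t).im : ℂ)) *
          Complex.I_mul_I
      rw [Complex.ofReal_add, Complex.ofReal_mul, hl, Complex.ofReal_div, Complex.ofReal_one,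
        ← Complex.mul_conj]
      field_simp
      linear_combination c.tangent t * (starRingEnd ℂ (c.point t) * c.tangent t -
        starRingEnd ℂ (c.tangent t) * c.point t) * Complex.I_mul_I
    · have hz0 := hz 0 c.zero_mem
      rw [norm_mul, norm_neg, norm_div, RCLike.norm_conj, c.norm_tangent,
        div_self (norm_pos_iff.2 hz0).ne', one_mul]
    · refine ⟨?_, h2, h3, h4, h5, h6, ?_⟩
      · rw [h1, CurveArc.carrier, image_image]
      · rw [h6]
        exact c.inversionCurvature_eq _ _

/-! ### Inversion at a point of a curve: rays and double rays. -/

/-- The position on a line of the inverse of the point at arc length `s` of a curve of curvature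
`k` that starts at the origin. -/
noncomputable def inverseCoord (k s : ℝ) : ℝ :=
  -- The tangent of the complementary angle is the cotangent of `|k| * s / 2`, in a form inverted by
  -- `arctan`.
  if k = 0 then 1 / s else |k| / 2 * Real.tan (Real.pi / 2 - |k| * s / 2)

theorem inverseCoord_neg (k s : ℝ) : inverseCoord (-k) s = inverseCoord k s := by
  simp [inverseCoord]

theorem image_inverseCoord {k l : ℝ} (hl : 0 < l) (hk : |k| * l < 2 * Real.pi) :
    inverseCoord k '' Ioc 0 l = Ici (inverseCoord k l) := by
  by_cases h0 : k = 0
  · ext y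
    simp only [inverseCoord, h0, if_true, mem_image, mem_Ioc, mem_Ici]
    constructor
    · rintro ⟨s, ⟨hs, hsl⟩, rfl⟩
      exact one_div_le_one_div_of_le hs hsl
    · intro hy
      have hy0 : 0 < y := (one_div_pos.2 hl).trans_le hy
      exact ⟨1 / y, ⟨one_div_pos.2 hy0, (one_div_le hl hy0).1 hy⟩, one_div_one_div y⟩
  · have hk0 : 0 < |k| := abs_pos.2 h0
    have hpos : 0 < |k| * l := mul_pos hk0 hl
    ext y
    simp only [inverseCoord, h0, if_false, mem_image, mem_Ioc, mem_Ici]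
    constructor
    · rintro ⟨s, ⟨hs, hsl⟩, rfl⟩
      have h1 : 0 < |k| * s := mul_pos hk0 hs
      have h2 : |k| * s ≤ |k| * l := mul_le_mul_of_nonneg_left hsl hk0.le
      refine mul_le_mul_of_nonneg_left ?_ (by positivity)
      refine Real.strictMonoOn_tan.monotoneOn ⟨?_, ?_⟩ ⟨?_, ?_⟩ ?_ <;> linarith
    · intro hy
      have h1 : Real.arctan (2 * y / |k|) < Real.pi / 2 := Real.arctan_lt_pi_div_two _
      have h2 : Real.pi / 2 - |k| * l / 2 ≤ Real.arctan (2 * y / |k|) := by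
        rw [← Real.arctan_tan (x := Real.pi / 2 - |k| * l / 2) (by linarith) (by linarith)]
        refine Real.arctan_strictMono.monotone ?_
        rw [le_div_iff₀ hk0]
        linarith
      refine ⟨(Real.pi / 2 - Real.arctan (2 * y / |k|)) * 2 / |k|, ⟨?_, ?_⟩, ?_⟩
      · have : 0 < Real.pi / 2 - Real.arctan (2 * y / |k|) := by linarith
        positivity
      · rw [div_le_iff₀ hk0]
        linarith
      · have : Real.pi / 2 - |k| * ((Real.pi / 2 - Real.arctan (2 * y / |k|)) * 2 / |k|) / 2 =
            Real.arctan (2 * y / |k|) := by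
          field_simp
          ring
        rw [this, Real.tan_arctan]
        field_simp

/-- The two half-lines coming from the parts before and after the point stay apart precisely because
the total turning is below `2π`. -/
theorem inverseCoord_add_pos {k a b : ℝ} (ha : 0 < a) (hb : 0 < b)
    (hk : |k| * (a + b) < 2 * Real.pi) : -inverseCoord k a < inverseCoord k b := by
  by_cases h0 : k = 0
  · simp only [inverseCoord, h0, if_true]
    have h1 := one_div_pos.2 ha
    have h2 := one_div_pos.2 hb
    linarith
  · have hk0 : 0 < |k| := abs_pos.2 h0
    have h1 := mul_pos hk0 ha
    have h2 := mul_pos hk0 hb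
    simp only [inverseCoord, h0, if_false]
    rw [← mul_neg, ← Real.tan_neg]
    refine mul_lt_mul_of_pos_left ?_ (by positivity)
    refine Real.strictMonoOn_tan ⟨?_, ?_⟩ ⟨?_, ?_⟩ ?_ <;> linarith

/-- For `κ ≠ 0` the chord is `T * (2/κ) * sin (κs/2) * exp (iκs/2)`, whose inverse is `conj T *
(κ/2) * (cot (κs/2) - i)`: only the real coordinate along a line varies. -/
theorem CurveArc.inv_point_forward (c : CurveArc) {t s : ℝ} (hs : 0 < s)
    (hsl : |c.curvature| * s < 2 * Real.pi) :
    (c.point (t + s) - c.point t)⁻¹ =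
      starRingEnd ℂ (c.tangent t) * (inverseCoord c.curvature s - c.curvature / 2 * Complex.I) := by
  have hT : c.tangent t * starRingEnd ℂ (c.tangent t) = 1 := by
    rw [Complex.mul_conj, Complex.normSq_eq_norm_sq, c.norm_tangent]
    norm_num
  apply inv_eq_of_mul_eq_one_right
  by_cases h0 : c.curvature = 0
  · rw [point_of_curvature_eq_zero c h0, point_of_curvature_eq_zero c h0, inverseCoord, if_pos h0]
    have hs' : (s : ℂ) ≠ 0 := by exact_mod_cast hs.ne'
    have hd : c.tangent t = c.dir := by simp [tangent, h0]
    rw [hd] at hT ⊢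
    rw [h0]
    push_cast
    field_simp
    linear_combination 2 * s * hT
  · set k := c.curvature with hk
    have hk0 : 0 < |k| := abs_pos.2 h0
    have hks := mul_pos hk0 hs
    have hsin : Real.sin (k * s / 2) ≠ 0 := by
      have h1 : Real.sin (|k| * s / 2) ≠ 0 :=
        (Real.sin_pos_of_pos_of_lt_pi (by linarith) (by linarith)).ne'
      rcases abs_choice k with h | h
      · rwa [h] at h1
      · rw [h, neg_mul, neg_div, Real.sin_neg] at h1
        exact neg_ne_zero.1 h1
    have hμ : inverseCoord k s = k / 2 * (Real.cos (k * s / 2) / Real.sin (k * s / 2)) := by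
      rw [inverseCoord, if_neg h0, Real.tan_pi_div_two_sub, Real.tan_eq_sin_div_cos, inv_div]
      rcases abs_choice k with h | h
      · rw [h]
      · rw [h, neg_mul, neg_div, neg_div, Real.sin_neg, Real.cos_neg, div_neg]
        ring
    have hE := c.tangent_sub_tangent t (t + s)
    rw [c.tangent_add] at hE
    have hk' : (k : ℂ) ≠ 0 := by exact_mod_cast h0
    have hexp : Complex.exp ((k * s : ℝ) * Complex.I) - 1 =
        2 * Complex.I * Real.sin (k * s / 2) *
          (Real.cos (k * s / 2) + Real.sin (k * s / 2) * Complex.I) := by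
      have h2 : ((k * s : ℝ) : ℂ) * Complex.I = ((k * s / 2 : ℝ) : ℂ) * Complex.I +
          ((k * s / 2 : ℝ) : ℂ) * Complex.I := by
        push_cast
        ring
      have h3 : ((Real.sin (k * s / 2) : ℝ) : ℂ) ^ 2 + ((Real.cos (k * s / 2) : ℝ) : ℂ) ^ 2 = 1 := by
        exact_mod_cast Real.sin_sq_add_cos_sq (k * s / 2)
      rw [h2, Complex.exp_add, Complex.exp_mul_I, ← Complex.ofReal_cos, ← Complex.ofReal_sin]
      linear_combination h3 + (-((Real.sin (k * s / 2) : ℝ) : ℂ) ^ 2) * Complex.I_sq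
    have hsin' : ((Real.sin (k * s / 2) : ℝ) : ℂ) ≠ 0 := by exact_mod_cast hsin
    have h3 : ((Real.sin (k * s / 2) : ℝ) : ℂ) ^ 2 + ((Real.cos (k * s / 2) : ℝ) : ℂ) ^ 2 = 1 := by
      exact_mod_cast Real.sin_sq_add_cos_sq (k * s / 2)
    apply mul_left_cancel₀ (mul_ne_zero Complex.I_ne_zero hk')
    have h4 : Complex.I * k * (c.point (t + s) - c.point t) = c.tangent t *
        (2 * Complex.I * Real.sin (k * s / 2) *
          (Real.cos (k * s / 2) + Real.sin (k * s / 2) * Complex.I)) := by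
      rw [← hexp]
      linear_combination -hE
    rw [← mul_assoc, h4, hμ]
    rw [Complex.ofReal_mul, Complex.ofReal_div, Complex.ofReal_div, Complex.ofReal_ofNat]
    generalize ((Real.sin (k * s / 2) : ℝ) : ℂ) = x at *
    generalize ((Real.cos (k * s / 2) : ℝ) : ℂ) = y at *
    field_simp
    linear_combination (y ^ 2 - Complex.I ^ 2 * x ^ 2) * hT + h3 - x ^ 2 * Complex.I_sq

/-- Formulated for real-affine `f` with linear part `g`, so that it applies to complex affine maps
and to conjugation alike. -/
theorem IsRay.image {f g : ℂ → ℂ} (hf : ∀ a v (t : ℝ), f (a + t * v) = f a + t * g v)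
    (hg : ∀ v, v ≠ 0 → g v ≠ 0) {X : Set ℂ} (hX : IsRay X) : IsRay (f '' X) := by
  obtain ⟨a, v, hv, rfl⟩ := hX
  refine ⟨f a, g v, hg v hv, ?_⟩
  ext w
  constructor
  · rintro ⟨z, ⟨t, ht, rfl⟩, rfl⟩
    exact ⟨t, ht, hf a v t⟩
  · rintro ⟨t, ht, rfl⟩
    exact ⟨_, ⟨t, ht, rfl⟩, hf a v t⟩

theorem IsDoubleRay.image {f g : ℂ → ℂ} (hf : ∀ a v (t : ℝ), f (a + t * v) = f a + t * g v)
    (hg : ∀ v, v ≠ 0 → g v ≠ 0) {X : Set ℂ} (hX : IsDoubleRay X) : IsDoubleRay (f '' X) := by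
  obtain ⟨a, v, s, hv, hs, rfl⟩ := hX
  refine ⟨f a, g v, s, hg v hv, hs, ?_⟩
  ext w
  constructor
  · rintro ⟨z, ⟨t, ht, rfl⟩, rfl⟩
    exact ⟨t, ht, hf a v t⟩
  · rintro ⟨t, ht, rfl⟩
    exact ⟨_, ⟨t, ht, rfl⟩, hf a v t⟩

/-- The part of a curve after a point, inverted at this point. -/
theorem CurveArc.image_inv_forward (c : CurveArc) {t : ℝ} (ht : t ∈ Ico 0 c.length) :
    (fun s => (c.point s - c.point t)⁻¹) '' Ioc t c.length =
      (fun y : ℝ => starRingEnd ℂ (c.tangent t) * (y - c.curvature / 2 * Complex.I)) ''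
        Ici (inverseCoord c.curvature (c.length - t)) := by
  have hturn : ∀ s ≤ c.length, |c.curvature| * s < 2 * Real.pi := fun s hs =>
    (mul_le_mul_of_nonneg_left hs (abs_nonneg _)).trans_lt c.turning_lt
  have hIoc : Ioc t c.length = (fun s => t + s) '' Ioc 0 (c.length - t) := by
    simp
  rw [← image_inverseCoord (sub_pos.2 ht.2) (hturn _ (by linarith [ht.1])), hIoc, image_image,
    image_image]
  refine image_congr fun s hs => ?_
  exact c.inv_point_forward hs.1 (hturn s (by linarith [hs.2, ht.1]))

theorem CurveArc.image_inv_backward (c : CurveArc) {t : ℝ} (ht : t ∈ Ioc 0 c.length) :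
    (fun s => (c.point s - c.point t)⁻¹) '' Ico 0 t =
      (fun y : ℝ => starRingEnd ℂ (c.tangent t) * (y - c.curvature / 2 * Complex.I)) ''
        Iic (-inverseCoord c.curvature t) := by
  have h := c.reverse.image_inv_forward (t := c.length - t)
    ⟨sub_nonneg.2 ht.2, by simpa [reverse] using ht.1⟩
  rw [show c.reverse.length = c.length from rfl,
    show c.reverse.curvature = -c.curvature from rfl, sub_sub_cancel, inverseCoord_neg,
    c.reverse_tangent, c.reverse_point, sub_sub_cancel] at h
  have hIco : Ico 0 t = (fun s => c.length - s) '' Ioc (c.length - t) c.length := by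
    simp
  have hIic : Iic (-inverseCoord c.curvature t) = (fun y => -y) ''
      Ici (inverseCoord c.curvature t) := by
    simp
  rw [hIco, image_image]
  simp only [c.reverse_point] at h
  rw [h, hIic, image_image]
  refine image_congr fun y _ => ?_
  simp only [map_neg]
  push_cast
  ring

/-- A curve inverted at one of its points is a ray or a double ray. -/
theorem CurveArc.isRay_or_isDoubleRay (c : CurveArc) {q : ℂ} (hq : q ∈ c.carrier) :
    IsRay ((fun z => (z - q)⁻¹) '' (c.carrier \ {q})) ∨
      IsDoubleRay ((fun z => (z - q)⁻¹) '' (c.carrier \ {q})) := by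
  obtain ⟨t, ht, rfl⟩ := hq
  have hset : (fun z => (z - c.point t)⁻¹) '' (c.carrier \ {c.point t}) =
      (fun s => (c.point s - c.point t)⁻¹) '' Ico 0 t ∪
      (fun s => (c.point s - c.point t)⁻¹) '' Ioc t c.length := by
    have h1 : c.carrier \ {c.point t} = c.point '' (Ico 0 t ∪ Ioc t c.length) := by
      have h2 : Ico 0 t ∪ Ioc t c.length = Icc 0 c.length \ {t} := by
        ext s
        simp only [mem_union, mem_Ico, mem_Ioc, Set.mem_sdiff, mem_Icc, mem_singleton_iff]
        constructor
        · rintro (⟨h1, h2⟩ | ⟨h1, h2⟩)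
          · exact ⟨⟨h1, h2.le.trans ht.2⟩, h2.ne⟩
          · exact ⟨⟨ht.1.trans h1.le, h2⟩, h1.ne'⟩
        · rintro ⟨⟨h1, h2⟩, h3⟩
          exact (lt_or_gt_of_ne h3).imp (fun h => ⟨h1, h⟩) fun h => ⟨h, h2⟩
      rw [h2, c.point_injOn.image_sdiff_subset (singleton_subset_iff.2 ht), image_singleton]
      rfl
    rw [h1, image_image, image_union]
  set v := starRingEnd ℂ (c.tangent t) with hv
  have hv0 : v ≠ 0 := by simpa [hv] using c.tangent_ne_zero t
  set b := v * -(c.curvature / 2 * Complex.I) with hb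
  rw [hset]
  rcases ht.1.eq_or_lt with h0 | h0
  · left
    have hL : t < c.length := h0 ▸ c.length_pos
    rw [c.image_inv_forward ⟨ht.1, hL⟩, ← h0, Ico_self, image_empty, empty_union]
    refine ⟨b + inverseCoord c.curvature (c.length - 0) * v, v, hv0, ?_⟩
    ext w
    simp only [mem_image, mem_Ici, mem_ofPred_eq]
    constructor
    · rintro ⟨y, hy, rfl⟩
      refine ⟨y - inverseCoord c.curvature (c.length - 0), sub_nonneg.2 hy, ?_⟩
      rw [h0]
      push_cast
      ring
    · rintro ⟨y, hy, rfl⟩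
      refine ⟨y + inverseCoord c.curvature (c.length - 0), by linarith, ?_⟩
      rw [h0]
      push_cast
      ring
  rcases ht.2.eq_or_lt with hL | hL
  · left
    rw [c.image_inv_backward ⟨h0, ht.2⟩, hL, Ioc_self, image_empty, union_empty, ← hL]
    refine ⟨b - inverseCoord c.curvature t * v, -v, neg_ne_zero.2 hv0, ?_⟩
    ext w
    simp only [mem_image, mem_Iic, mem_ofPred_eq]
    constructor
    · rintro ⟨y, hy, rfl⟩
      refine ⟨-y - inverseCoord c.curvature t, by linarith, ?_⟩
      push_cast
      ring
    · rintro ⟨y, hy, rfl⟩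
      refine ⟨-y - inverseCoord c.curvature t, by linarith, ?_⟩
      push_cast
      ring
  · right
    rw [c.image_inv_forward ⟨ht.1, hL⟩, c.image_inv_backward ⟨h0, ht.2⟩, ← image_union]
    have hpos := inverseCoord_add_pos (k := c.curvature) h0 (sub_pos.2 hL)
      (by rw [add_sub_cancel]; exact c.turning_lt)
    set m := inverseCoord c.curvature t
    set m' := inverseCoord c.curvature (c.length - t)
    refine ⟨b - m * v, v, m' + m, hv0, by linarith, ?_⟩
    ext w
    simp only [mem_image, mem_union, mem_Iic, mem_Ici, mem_ofPred_eq]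
    constructor
    · rintro ⟨y, hy, rfl⟩
      refine ⟨y + m, hy.imp (fun h => by linarith) (fun h => by linarith), ?_⟩
      push_cast
      ring
    · rintro ⟨y, hy, rfl⟩
      refine ⟨y - m, hy.imp (fun h => by linarith) (fun h => by linarith), ?_⟩
      push_cast
      ring

/-! ### General Möbius transformations. -/

theorem isSoapBubbleCluster_smul {B : Set (Set ℂ)} (hB : IsSoapBubbleCluster B)
    (g : GL (Fin 2) ℂ)
    (hray : ∀ X ∈ B, ¬ IsRay (planeImage (fun z => g • z) X) ∧
      ¬ IsDoubleRay (planeImage (fun z => g • z) X)) :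
    IsSoapBubbleCluster (planeImage (fun z => g • z) '' B) := by
  have hdet : g 0 0 * g 1 1 - g 0 1 * g 1 0 ≠ 0 := by
    rw [← Matrix.det_fin_two]
    exact g.det_ne_zero
  by_cases hc : g 1 0 = 0
  · rw [hc, mul_zero, sub_zero] at hdet
    have ha := left_ne_zero_of_mul hdet
    have hd := right_ne_zero_of_mul hdet
    have himg : planeImage (fun z => g • z) =
        fun X => (fun z => g 0 0 / g 1 1 * z + g 0 1 / g 1 1) '' X := by
      funext X
      ext w
      simp only [planeImage, mem_ofPred_eq, mem_image, OnePoint.smul_some_eq_ite, hc, zero_mul,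
        zero_add, hd, if_false]
      refine exists_congr fun z => and_congr_right fun _ => ?_
      rw [OnePoint.coe_eq_coe, add_div, mul_div_right_comm]
    rw [himg]
    exact isSoapBubbleCluster_affine hB (div_ne_zero ha hd) _
  -- Here `q` is the pole, and partial fractions write the map as `α / (z - q)` plus a constant.
  · set q := -(g 1 1 / g 1 0) with hq
    set α := -(g 0 0 * g 1 1 - g 0 1 * g 1 0) / g 1 0 ^ 2 with hα
    have hα0 : α ≠ 0 := div_ne_zero (neg_ne_zero.2 hdet) (pow_ne_zero _ hc)
    have himg : ∀ X, planeImage (fun z => g • z) X =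
        (fun z => α * z + g 0 0 / g 1 0) '' ((fun z => (z - q)⁻¹) '' (X \ {q})) := by
      intro X
      ext w
      rw [image_image]
      simp only [planeImage, mem_ofPred_eq, mem_image, OnePoint.smul_some_eq_ite, Set.mem_sdiff,
        mem_singleton_iff]
      have hzq : ∀ z, g 1 0 * z + g 1 1 = g 1 0 * (z - q) := by
        intro z
        rw [hq]
        field_simp
        ring
      have hval : ∀ z, z ≠ q → (g 0 0 * z + g 0 1) / (g 1 0 * z + g 1 1) =
          α * (z - q)⁻¹ + g 0 0 / g 1 0 := by
        intro z hz
        have hz' := sub_ne_zero.2 hz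
        have h1 : g 1 0 * q = -g 1 1 := by
          rw [hq]
          field_simp
        rw [hzq, hα]
        field_simp
        linear_combination g 0 0 * h1
      constructor
      · rintro ⟨z, hz, h⟩
        by_cases hzq' : z = q
        · rw [hzq, hzq', sub_self, mul_zero, if_pos rfl] at h
          exact absurd h (OnePoint.infty_ne_coe w)
        · rw [if_neg (by rw [hzq]; exact mul_ne_zero hc (sub_ne_zero.2 hzq')),
            OnePoint.coe_eq_coe, hval z hzq'] at h
          exact ⟨z, ⟨hz, hzq'⟩, h⟩
      · rintro ⟨z, ⟨hz, hzq'⟩, h⟩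
        refine ⟨z, hz, ?_⟩
        rw [if_neg (by rw [hzq]; exact mul_ne_zero hc (sub_ne_zero.2 hzq')), hval z hzq', h]
    -- The assumption on rays enters here: a curve through the pole would have a ray or a double ray
    -- as its image.
    have hqB : ∀ X ∈ B, q ∉ X := by
      intro X hX hqX
      have h := hray X hX
      obtain ⟨S, rfl, -⟩ := hB
      obtain ⟨c, -, rfl⟩ := hX
      rw [himg] at h
      have hf : ∀ a v (t : ℝ), α * (a + t * v) + g 0 0 / g 1 0 =
          (α * a + g 0 0 / g 1 0) + t * (α * v) := by
        intro a v t
        ring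
      rcases c.isRay_or_isDoubleRay hqX with h' | h'
      · exact h.1 (h'.image hf fun v hv => mul_ne_zero hα0 hv)
      · exact h.2 (h'.image hf fun v hv => mul_ne_zero hα0 hv)
    have h1 := isSoapBubbleCluster_affine hB one_ne_zero (-q)
    have h2 := isSoapBubbleCluster_inv h1 (by
      rintro _ ⟨X, hX, rfl⟩ ⟨z, hz, h0⟩
      refine hqB X hX ?_
      rwa [show q = z by linear_combination -h0])
    have h3 := isSoapBubbleCluster_affine h2 hα0 (g 0 0 / g 1 0)
    convert h3 using 1
    rw [image_image, image_image]
    refine image_congr fun X hX => ?_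
    rw [himg, sdiff_singleton_eq_self (hqB X hX), image_image, image_image]
    simp only [image_image, one_mul, sub_eq_add_neg]

theorem mainTheorem4 (B : Set (Set ℂ)) (hB : IsSoapBubbleCluster B)
    (τ : OnePoint ℂ → OnePoint ℂ) (hτ : IsMobius τ)
    (hray : ∀ X ∈ B, ¬ IsRay (planeImage τ X) ∧ ¬ IsDoubleRay (planeImage τ X)) :
    IsSoapBubbleCluster (planeImage τ '' B) := by
  obtain ⟨g, hg | hg⟩ := hτ
  · obtain rfl : τ = fun z => g • z := funext hg
    exact isSoapBubbleCluster_smul hB g hray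
  · have himg : ∀ X, planeImage τ X = starRingEnd ℂ '' planeImage (fun z => g • z) X := by
      intro X
      ext w
      simp only [planeImage, mem_ofPred_eq, mem_image, hg]
      constructor
      · rintro ⟨z, hz, h⟩
        generalize hy : g • (z : OnePoint ℂ) = y at h
        induction y using OnePoint.rec with
        | infty => simp at h
        | coe y =>
          rw [OnePoint.map_some, OnePoint.coe_eq_coe] at h
          exact ⟨y, ⟨z, hz, hy⟩, h⟩
      · rintro ⟨y, ⟨z, hz, hy⟩, rfl⟩
        exact ⟨z, hz, by rw [hy, OnePoint.map_some]⟩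
    have hf : ∀ a v (t : ℝ), starRingEnd ℂ (a + t * v) =
        starRingEnd ℂ a + t * starRingEnd ℂ v := by
      intro a v t
      simp
    have hconj : ∀ v, v ≠ 0 → starRingEnd ℂ v ≠ 0 := by
      intro v hv
      simpa using hv
    have h1 := isSoapBubbleCluster_smul hB g fun X hX => by
      have h := hray X hX
      rw [himg] at h
      exact ⟨fun h' => h.1 (h'.image hf hconj), fun h' => h.2 (h'.image hf hconj)⟩
    have h2 := isSoapBubbleCluster_conj h1
    rw [image_image] at h2
    rwa [funext himg]
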